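/- **Theorem.** Let $\Gamma$ be a finite, simple, connected, undirected, non-bipartite distance-regular graph with vertex set $X$, path-length distance $\partial$, diameter $D\ge 3$ and intersection numbers $p^h_{ij}=|\{w:\partial(y,w)=i,\ \partial(z,w)=j\}|$ for $\partial(y,z)=h$; write $c_i=p^i_{1,i-1}$, $a_i=p^i_{1,i}$, $b_i=p^i_{1,i+1}$. Suppose that $\Gamma$ is of negative type, that is, there are real numbers $q,\alpha,\beta$ with $q<-1$ such that, with $[j]=1+q+\cdots+q^{j-1}$, $$c_i=[i]\,(1+\alpha[i-1])\quad(1\le i\le D),\qquad b_i=([D]-[i])(\beta-\alpha[i])\quad(0\le i\le D-1),$$ and suppose that $a_1=0$. Then, for every vertex $x\in X$, $\Gamma$ does not support a uniform structure with respect to $x$. Here $\Gamma$ is said to support a uniform structure with respect to $x$ if the following holds. Let $\Gamma_f$ be the bipartite graph obtained from $\Gamma$ by deleting all edges $yz$ with $\partial(x,y)=\partial(x,z)$, let $A$ be its adjacency matrix over $\mathbb C$, let $\varepsilon$ be the eccentricity of $x$ in $\Gamma_f$, let $E_i^*$ be the diagonal matrix with $(y,y)$-entry $1$ if $y$ has distance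 $i$ from $x$ in $\Gamma_f$ and $0$ otherwise, let $V=\mathbb C^X$, and put $L=\sum_{i=1}^{\varepsilon}E^*_{i-1}AE^*_i$ and $R=\sum_{i=0}^{\varepsilon-1}E^*_{i+1}AE^*_i$. Then there are a vector $(f_i)_{i=1}^{\varepsilon}\in\mathbb C^{\varepsilon}$ and a complex tridiagonal matrix $U=(e_{ij})_{1\le i,j\le\varepsilon}$ such that 1. $e_{ii}=1$ for $1\le i\le\varepsilon$; 2. either $e_{i,i-1}\ne0$ for all $2\le i\le\varepsilon$, or $e_{i-1,i}\ne0$ for all $2\le i\le\varepsilon$; 3. the principal submatrix $(e_{ij})_{s\le i,j\le t}$ is nonsingular whenever $1\le s\le t\le\varepsilon$; 4. for $1\le i\le\varepsilon$, the equation $e_i^-RL^2+LRL+e_i^+L^2R=f_iL$ holds on $E_i^*V$, where $e_i^-=e_{i,i-1}$ for $2\le i\le\varepsilon$, $e_i^+=e_{i,i+1}$ for $1\le i\le\varepsilon-1$, and $e_1^-=e_\varepsilon^+=0$. -/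

import Mathlib

open Matrix

namespace SimpleGraph

variable {X : Type*}

/-- `G` is a (connected) distance-regular graph with intersection numbers
`p h i j = p^h_{ij}` for `0 ≤ h, i, j ≤ D`, where `D` is the diameter. The values of `p` at
indices larger than `D` carry no meaning. -/
def IsDistanceRegularWith (G : SimpleGraph X) (p : ℕ → ℕ → ℕ → ℕ) : Prop :=
  G.Connected ∧
    ∀ h i j : ℕ, h ≤ G.diam → i ≤ G.diam → j ≤ G.diam →
      ∀ y z : X, G.dist y z = h → {w : X | G.dist y w = i ∧ G.dist z w = j}.ncard = p h i j

/-- The bracket `[j; 1] = 1 + q + q ^ 2 + ⋯ + q ^ (j - 1)`. -/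
noncomputable def qBracket (q : ℝ) (j : ℕ) : ℝ := ∑ k ∈ Finset.range j, q ^ k

/-- The intersection numbers `c_i = p^i_{1,i-1}` and `b_i = p^i_{1,i+1}` are those of a graph
with classical parameters `(D, q, α, β)`. -/
def HasClassicalParameters (p : ℕ → ℕ → ℕ → ℕ) (D : ℕ) (q α β : ℝ) : Prop :=
  (∀ i : ℕ, 1 ≤ i → i ≤ D →
    (p i 1 (i - 1) : ℝ) = qBracket q i * (1 + α * qBracket q (i - 1))) ∧
  (∀ i : ℕ, i < D →
    (p i 1 (i + 1) : ℝ) = (qBracket q D - qBracket q i) * (β - α * qBracket q i))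

/-- The graph with intersection numbers `p` and diameter `D` is of negative type. -/
def IsNegativeType (p : ℕ → ℕ → ℕ → ℕ) (D : ℕ) : Prop :=
  ∃ q α β : ℝ, HasClassicalParameters p D q α β ∧ q < -1

/-- The eccentricity `ε(x)` as a natural number (for a finite connected graph). -/
noncomputable def eccentricity (G : SimpleGraph X) (x : X) : ℕ := (G.eccent x).toNat

/-- The adjacency matrix with complex entries. -/
noncomputable def complexAdjMatrix (G : SimpleGraph X) : Matrix X X ℂ :=
  open Classical in G.adjMatrix ℂ

/-- The dual idempotent `E*_i` with respect to `x`. -/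
noncomputable def dualIdempotent [DecidableEq X] (G : SimpleGraph X) (x : X) (i : ℕ) :
    Matrix X X ℂ :=
  Matrix.diagonal fun y => if G.dist x y = i then 1 else 0

/-- The subconstituent `E*_i V`, where `V = ℂ^X` is the standard module. -/
noncomputable def subconstituent [Fintype X] [DecidableEq X] (G : SimpleGraph X) (x : X) (i : ℕ) :
    Submodule ℂ (X → ℂ) :=
  LinearMap.range (Matrix.mulVecLin (G.dualIdempotent x i))

/-- The lowering matrix `L` with respect to `x`. -/
noncomputable def loweringMatrix [Fintype X] [DecidableEq X] (G : SimpleGraph X) (x : X) :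
    Matrix X X ℂ :=
  ∑ i ∈ Finset.Icc 1 (G.eccentricity x),
    G.dualIdempotent x (i - 1) * G.complexAdjMatrix * G.dualIdempotent x i

/-- The raising matrix `R` with respect to `x`. -/
noncomputable def raisingMatrix [Fintype X] [DecidableEq X] (G : SimpleGraph X) (x : X) :
    Matrix X X ℂ :=
  ∑ i ∈ Finset.range (G.eccentricity x),
    G.dualIdempotent x (i + 1) * G.complexAdjMatrix * G.dualIdempotent x i

/-- `U = (e_{ij})_{1 ≤ i, j ≤ ε}` is a parameter matrix. The matrix is written with natural
number indices; only the entries with indices in `1, …, ε` are used. -/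
structure IsParameterMatrix (ε : ℕ) (U : Matrix ℕ ℕ ℂ) : Prop where
  tridiagonal : ∀ i ∈ Finset.Icc 1 ε, ∀ j ∈ Finset.Icc 1 ε, i + 1 < j ∨ j + 1 < i → U i j = 0
  diag : ∀ i ∈ Finset.Icc 1 ε, U i i = 1
  off_diag : (∀ i ∈ Finset.Icc 2 ε, U i (i - 1) ≠ 0) ∨ (∀ i ∈ Finset.Icc 2 ε, U (i - 1) i ≠ 0)
  nonsingular : ∀ s t : ℕ, 1 ≤ s → s ≤ t → t ≤ ε →
    (U.submatrix (fun i : Finset.Icc s t => (i : ℕ)) (fun j : Finset.Icc s t => (j : ℕ))).det ≠ 0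

/-- `e⁻_i = e_{i,i-1}` for `2 ≤ i ≤ ε`, with the convention `e⁻_1 = 0`. -/
noncomputable def eMinus (U : Matrix ℕ ℕ ℂ) (i : ℕ) : ℂ := if 2 ≤ i then U i (i - 1) else 0

/-- `e⁺_i = e_{i,i+1}` for `1 ≤ i ≤ ε - 1`, with the convention `e⁺_ε = 0`. -/
noncomputable def ePlus (ε : ℕ) (U : Matrix ℕ ℕ ℂ) (i : ℕ) : ℂ := if i < ε then U i (i + 1) else 0

/-- `(U, f)` is a uniform structure of the (bipartite) graph `G` with respect to `x`:
`U` is a parameter matrix and `e⁻_i R L² + L R L + e⁺_i L² R = f_i L` holds on `E*_i V`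
for `1 ≤ i ≤ ε`. -/
structure IsUniformStructure [Fintype X] [DecidableEq X] (G : SimpleGraph X) (x : X)
    (U : Matrix ℕ ℕ ℂ) (f : ℕ → ℂ) : Prop where
  isParameterMatrix : IsParameterMatrix (G.eccentricity x) U
  uniform : ∀ i ∈ Finset.Icc 1 (G.eccentricity x), ∀ v ∈ G.subconstituent x i,
    (eMinus U i • (G.raisingMatrix x * G.loweringMatrix x ^ 2)
      + G.loweringMatrix x * G.raisingMatrix x * G.loweringMatrix x
      + ePlus (G.eccentricity x) U i • (G.loweringMatrix x ^ 2 * G.raisingMatrix x)) *ᵥ v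
      = (f i • G.loweringMatrix x) *ᵥ v

/-- The graph `G_f(x)`: delete all edges `yz` of `G` with `∂(x, y) = ∂(x, z)`. -/
def flatDeleted (G : SimpleGraph X) (x : X) : SimpleGraph X where
  Adj y z := G.Adj y z ∧ G.dist x y ≠ G.dist x z
  symm := ⟨fun _ _ h => ⟨h.1.symm, h.2.symm⟩⟩
  loopless := ⟨fun _ h => h.2 rfl⟩

/-- The graph `G` supports a uniform structure with respect to `x`. -/
def SupportsUniformStructure [Fintype X] [DecidableEq X] (G : SimpleGraph X) (x : X) : Prop :=
  ∃ (U : Matrix ℕ ℕ ℂ) (f : ℕ → ℂ), (G.flatDeleted x).IsUniformStructure x U f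

end SimpleGraph

/-! Put r = q⁻¹. On functions with sum zero the matrix with entries r ^ d(u, v) is a positive
multiple of a projection, because for classical parameters r ^ i and the constants span an invariant
space of the intersection matrix (`exists_sum_mul_sum_pow_dist`). Hence a sum-zero function whose
product with its image under this matrix is nowhere positive lies in the kernel
(`sum_pow_dist_eq_zero`).

For d(y, z) = 3, apply this to the difference of the neighbours of y towards z and those of z
towards y, corrected by a multiple of y - z. Triangle-freeness and q < -1 give the required signs,
so the balanced set condition holds (`balanced_three`); a double count carries it to distance four
(`balanced_four`). The two conditions exclude parallelograms of length three and four
(`dist_add_one_ne`) and determine the neighbour counts needed between the cells (d(x, ·), d(z, ·))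
of an edge xz.

Now apply the uniformity equation on the third subconstituent of x to functions g of the distance to
z, and evaluate at vertices y with d(x, y) = 2 and d(z, y) = 2 or 1. Choosing g so that Lg vanishes
at y removes the scalar f and leaves linear relations between e⁻, e⁺ and the intersection numbers
(`relations_of_uniform`, `relations_of_uniform'`). Since c₂ ≥ 1 forces α < -1, sign considerations
make these relations inconsistent, separately for D ≥ 4 (`relations_absurd`) and D = 3
(`relations_absurd_of_diam_three`). -/

namespace SimpleGraph

open Finset

/-! ### Neighbours sorted by distance to a base vertex -/

section Neighbours

variable {X : Type*} {G : SimpleGraph X} {x y z w : X}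

lemma Connected.dist_le_dist_add_one (hG : G.Connected) (x : X) (h : G.Adj y w) :
    G.dist x w ≤ G.dist x y + 1 := by
  have := hG.dist_triangle (u := x) (v := y) (w := w)
  rwa [dist_eq_one_iff_adj.2 h] at this

lemma Connected.exists_adj_dist_add_one (hG : G.Connected) (h : x ≠ y) :
    ∃ w, G.Adj y w ∧ G.dist x w + 1 = G.dist x y := by
  obtain ⟨p, hp⟩ := hG.exists_walk_length_eq_dist y x
  cases p with
  | nil => exact absurd rfl h
  | @cons _ w _ ha p =>
    refine ⟨w, ha, ?_⟩
    have h₁ := dist_le p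
    have h₂ := hG.dist_le_dist_add_one x ha.symm
    rw [Walk.length_cons] at hp
    rw [dist_comm (u := y)] at hp
    rw [dist_comm (u := w)] at h₁
    omega

variable [Fintype X]

/-- The neighbours of `y` that are one step closer to `x` than `y` is. -/
noncomputable def lowerNbrs (G : SimpleGraph X) (x y : X) : Finset X :=
  open Classical in {w | G.Adj y w ∧ G.dist x w + 1 = G.dist x y}

/-- The neighbours of `y` that are one step further from `x` than `y` is. -/
noncomputable def upperNbrs (G : SimpleGraph X) (x y : X) : Finset X :=
  open Classical in {w | G.Adj y w ∧ G.dist x w = G.dist x y + 1}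

@[simp]
lemma mem_lowerNbrs : w ∈ G.lowerNbrs x y ↔ G.Adj y w ∧ G.dist x w + 1 = G.dist x y := by
  simp [lowerNbrs]

@[simp]
lemma mem_upperNbrs : w ∈ G.upperNbrs x y ↔ G.Adj y w ∧ G.dist x w = G.dist x y + 1 := by
  simp [upperNbrs]

/-- Sums of a function of the distance to `x` over the neighbours of `y`. -/
lemma Connected.sum_neighborFinset_dist (hG : G.Connected) [DecidableRel G.Adj] (F : ℕ → ℝ)
    (x y : X) :
    ∑ w ∈ G.neighborFinset y, F (G.dist x w) =
      G.degree y * F (G.dist x y) +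
        #(G.lowerNbrs x y) * (F (G.dist x y - 1) - F (G.dist x y)) +
        #(G.upperNbrs x y) * (F (G.dist x y + 1) - F (G.dist x y)) := by
  classical
  have key : ∀ w ∈ G.neighborFinset y, F (G.dist x w) = F (G.dist x y) +
      (if G.dist x w + 1 = G.dist x y then F (G.dist x y - 1) - F (G.dist x y) else 0) +
      (if G.dist x w = G.dist x y + 1 then F (G.dist x y + 1) - F (G.dist x y) else 0) := by
    intro w hw
    rw [mem_neighborFinset] at hw
    have h₁ := hG.dist_le_dist_add_one x hw
    have h₂ := hG.dist_le_dist_add_one x hw.symm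
    rcases (by omega : G.dist x w + 1 = G.dist x y ∨ G.dist x w = G.dist x y + 1 ∨
      G.dist x w = G.dist x y) with h | h | h
    · rw [if_pos h, if_neg (by omega), show G.dist x w = G.dist x y - 1 by omega]; ring
    · rw [if_neg (by omega), if_pos h, h]; ring
    · rw [if_neg (by omega), if_neg (by omega), h]; ring
  rw [sum_congr rfl key, sum_add_distrib, sum_add_distrib, sum_const, card_neighborFinset_eq_degree,
    ← sum_filter, ← sum_filter, sum_const, sum_const]
  have e₁ : {w ∈ G.neighborFinset y | G.dist x w + 1 = G.dist x y} = G.lowerNbrs x y := by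
    ext w; simp
  have e₂ : {w ∈ G.neighborFinset y | G.dist x w = G.dist x y + 1} = G.upperNbrs x y := by
    ext w; simp
  rw [e₁, e₂]
  simp only [nsmul_eq_mul]

end Neighbours

/-! ### The idempotent attached to powers of the distance -/

section DistancePowers

variable {X : Type*} [Fintype X] {G : SimpleGraph X}

/-- In a distance-regular graph, sums of a function of the distances to two vertices depend only on
the distance between these. -/
lemma IsDistanceRegularWith.exists_sum_eq {p : ℕ → ℕ → ℕ → ℕ} (h : G.IsDistanceRegularWith p)
    (φ : ℕ → ℕ → ℝ) :
    ∃ H : ℕ → ℝ, ∀ y z, ∑ w, φ (G.dist y w) (G.dist z w) = H (G.dist y z) := by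
  classical
  have hle : ∀ u v, G.dist u v ≤ G.diam := fun u v => by
    have := h.1.nonempty
    exact dist_le_diam (connected_iff_ediam_ne_top.1 h.1)
  refine ⟨fun n => ∑ t ∈ range (G.diam + 1) ×ˢ range (G.diam + 1), p n t.1 t.2 * φ t.1 t.2,
    fun y z => ?_⟩
  rw [← sum_fiberwise_of_maps_to (s := univ) (t := range (G.diam + 1) ×ˢ range (G.diam + 1))
    (g := fun w => (G.dist y w, G.dist z w))
    (fun w _ => by simp [hle])]
  refine sum_congr rfl fun t ht => ?_
  rw [mem_product, mem_range, mem_range] at ht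
  rw [← h.2 _ t.1 t.2 (hle y z) (by omega) (by omega) y z rfl, ← nsmul_eq_mul,
    Set.ncard_eq_toFinset_card', ← sum_const]
  refine sum_congr ?_ fun w hw => ?_
  · ext w
    simp [Prod.ext_iff]
  · rw [Set.mem_toFinset] at hw
    rw [hw.1, hw.2]

/-- The matrix with entries `r ^ d(u, v)`, restricted to functions with sum zero, is a positive
multiple of a projection, provided `n ↦ r ^ n` spans with the constants an invariant space of the
intersection matrix. -/
lemma exists_sum_mul_sum_pow_dist {p : ℕ → ℕ → ℕ → ℕ} (h : G.IsDistanceRegularWith p)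
    [Nontrivial X] {r C₀ C₁ k : ℝ} (hr : |r| < 1) [DecidableRel G.Adj]
    (hk : ∀ y, (G.degree y : ℝ) = k) {b c : ℕ → ℝ}
    (hc : ∀ x y, (#(G.lowerNbrs x y) : ℝ) = c (G.dist x y))
    (hb : ∀ x y, (#(G.upperNbrs x y) : ℝ) = b (G.dist x y))
    (hC : ∀ i, i ≤ G.diam →
      c i * (r ^ (i - 1) - r ^ i) + b i * (r ^ (i + 1) - r ^ i) = C₁ * r ^ i + C₀) :
    ∃ s : ℝ, 0 < s ∧ ∀ f : X → ℝ, ∑ v, f v = 0 →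
      s * ∑ v, f v * ∑ u, f u * r ^ G.dist u v = ∑ v, (∑ u, f u * r ^ G.dist u v) ^ 2 := by
  classical
  have hG := h.1
  have hle : ∀ u v, G.dist u v ≤ G.diam := fun u v =>
    dist_le_diam (connected_iff_ediam_ne_top.1 h.1)
  obtain ⟨S, hS⟩ := h.exists_sum_eq fun i _ => r ^ i
  have hS' : ∀ y, ∑ w, r ^ G.dist y w = S 0 := fun y => by
    have := hS y y
    rwa [dist_self] at this
  have hX : (0 : ℝ) < Fintype.card X := by exact_mod_cast Fintype.card_pos
  set m : ℝ := S 0 / Fintype.card X with hm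
  -- Summing the recurrence over all y counts each value k times on both sides, so C₁ S(0) + C₀ |X|
  -- = 0. Subtracting the mean m from r ^ n therefore gives a genuine eigenvector θ, with eigenvalue
  -- k + C₁.
  have hCm : C₀ = -(C₁ * m) := by
    obtain ⟨x⟩ := hG.nonempty
    have h₁ : ∀ y, ∑ w ∈ G.neighborFinset y, r ^ G.dist x w =
        k * r ^ G.dist x y + (C₁ * r ^ G.dist x y + C₀) := fun y => by
      rw [hG.sum_neighborFinset_dist (fun n => r ^ n), hk, hc, hb, ← hC _ (hle x y)]
      ring
    have h₂ : ∑ y, ∑ w ∈ G.neighborFinset y, r ^ G.dist x w = k * S 0 := by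
      rw [sum_comm' (t' := univ) (s' := fun w => G.neighborFinset w)
        (by simp [adj_comm]), ← hS' x, mul_sum]
      refine sum_congr rfl fun w _ => ?_
      rw [sum_const, card_neighborFinset_eq_degree, nsmul_eq_mul, hk]
    simp_rw [h₁, sum_add_distrib, ← mul_sum, hS' x, sum_const, nsmul_eq_mul, card_univ] at h₂
    rw [hm]
    field_simp
    linarith
  set θ : ℕ → ℝ := fun n => r ^ n - m with hθ
  have hθ₀ : 0 < θ 0 := by
    obtain ⟨x, y, hxy⟩ := exists_pair_ne X
    have : S 0 < Fintype.card X := by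
      rw [← hS' x, Fintype.card_eq_sum_ones, Nat.cast_sum]
      refine sum_lt_sum (fun w _ => ?_) ⟨y, mem_univ _, ?_⟩
      · rw [Nat.cast_one]
        exact (le_abs_self _).trans (by rw [abs_pow]; exact pow_le_one₀ (abs_nonneg _) hr.le)
      · rw [Nat.cast_one]
        exact (le_abs_self _).trans_lt
          (by rw [abs_pow]; exact pow_lt_one₀ (abs_nonneg _) hr (hG.pos_dist_of_ne hxy).ne')
    simp only [hθ, pow_zero, sub_pos, hm]
    rwa [div_lt_one hX]
  have hrec : ∀ x y, ∑ w ∈ G.neighborFinset y, θ (G.dist x w) = (k + C₁) * θ (G.dist x y) := by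
    intro x y
    rw [hG.sum_neighborFinset_dist θ, hk, hc, hb]
    have := hC _ (hle x y)
    simp only [hθ]
    linear_combination this + hCm
  -- H gives the entries of the square of the matrix θ(d(u, v)). It obeys the same three-term
  -- recurrence as θ, hence is proportional to it.
  obtain ⟨H, hH⟩ := h.exists_sum_eq fun i j => θ i * θ j
  have hHrec : ∀ x y, ∑ w ∈ G.neighborFinset y, H (G.dist x w) = (k + C₁) * H (G.dist x y) := by
    intro x y
    simp_rw [← hH]
    rw [sum_comm, mul_sum]
    refine sum_congr rfl fun v _ => ?_
    rw [← mul_sum, mul_left_comm, dist_comm (u := y), ← hrec v y]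
    simp_rw [dist_comm (v := v)]
  have hprop : ∀ n, ∀ x y, G.dist x y = n → H n = H 0 / θ 0 * θ n := by
    intro n
    induction n using Nat.strong_induction_on with
    | _ n ih =>
      intro x y hxy
      rcases n with _ | n
      · field_simp
      have hne : x ≠ y := fun e => by simp [e] at hxy
      obtain ⟨w, hw, hwd⟩ := hG.exists_adj_dist_add_one hne
      have hwn : G.dist x w = n := by omega
      have hpos : 0 < b n := by
        rw [← hwn, ← hb, Nat.cast_pos, card_pos]
        exact ⟨y, by simp [hw.symm, hwd]⟩
      have e₁ := hHrec x w
      have e₂ := hrec x w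
      rw [hG.sum_neighborFinset_dist, hk, hc, hb, hwn] at e₁ e₂
      have e₃ := ih n (by omega) x w hwn
      -- For n = 0 the truncated index n - 1 is 0, where proportionality is immediate.
      have e₄ : c n * H (n - 1) = c n * (H 0 / θ 0 * θ (n - 1)) := by
        rcases n with _ | n
        · simp only [zero_tsub, mul_eq_mul_left_iff]
          left
          field_simp
        · have hne : x ≠ w := fun e => by simp [e] at hwn
          obtain ⟨v, hv, hvd⟩ := hG.exists_adj_dist_add_one hne
          rw [ih (n + 1 - 1) (by omega) x v (by omega)]
      refine mul_left_cancel₀ hpos.ne' ?_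
      rw [e₃] at e₁
      linear_combination e₁ - H 0 / θ 0 * e₂ - e₄
  have hH₀ : 0 < H 0 := by
    obtain ⟨x⟩ := hG.nonempty
    rw [← dist_self (G := G) (v := x), ← hH]
    refine sum_pos' (fun w _ => mul_self_nonneg _) ⟨x, mem_univ _, ?_⟩
    rw [dist_self]
    exact mul_pos hθ₀ hθ₀
  refine ⟨H 0 / θ 0, div_pos hH₀ hθ₀, fun f hf => ?_⟩
  have hfθ : ∀ v, ∑ u, f u * r ^ G.dist u v = ∑ u, f u * θ (G.dist u v) := fun v => by
    simp only [hθ, mul_sub, sum_sub_distrib, ← sum_mul, hf]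
    ring
  simp_rw [hfθ, sq, sum_mul_sum]
  rw [mul_sum, sum_comm]
  refine sum_congr rfl fun v _ => ?_
  rw [mul_sum, mul_sum, sum_comm]
  refine sum_congr rfl fun u _ => ?_
  rw [show H 0 / θ 0 * (f v * (f u * θ (G.dist u v))) =
    f v * f u * (H 0 / θ 0 * θ (G.dist u v)) by ring, ← hprop _ u v rfl, ← hH, mul_sum]
  refine sum_congr rfl fun w _ => ?_
  ring

/-- A sum-zero function `f` whose product with its image under the matrix `r ^ d(u, v)` is nowhere
positive lies in the kernel of that matrix. -/
lemma sum_pow_dist_eq_zero {r s : ℝ} (hs : 0 < s)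
    (h : ∀ f : X → ℝ, ∑ v, f v = 0 →
      s * ∑ v, f v * ∑ u, f u * r ^ G.dist u v = ∑ v, (∑ u, f u * r ^ G.dist u v) ^ 2)
    {f : X → ℝ} (hf : ∑ v, f v = 0) (hneg : ∀ v, f v * ∑ u, f u * r ^ G.dist u v ≤ 0) (v : X) :
    ∑ u, f u * r ^ G.dist u v = 0 := by
  have h₁ : ∑ v, (∑ u, f u * r ^ G.dist u v) ^ 2 ≤ 0 := by
    rw [← h f hf]
    exact mul_nonpos_of_nonneg_of_nonpos hs.le (sum_nonpos fun v _ => hneg v)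
  have h₂ := (sum_eq_zero_iff_of_nonneg fun v _ => sq_nonneg _).1
    (le_antisymm h₁ (sum_nonneg fun v _ => sq_nonneg _)) v (mem_univ v)
  exact pow_eq_zero_iff two_ne_zero |>.1 h₂

end DistancePowers

/-! ### Balanced set conditions at distances three and four -/

section Fibres

variable {X : Type*}

/-- A sum over a finite set on which an integer function takes three consecutive values. -/
lemma sum_eq_of_three_values (S : Finset X) (d : X → ℕ) (F : ℕ → ℝ) (i : ℕ)
    (h : ∀ w ∈ S, d w = i ∨ d w = i + 1 ∨ d w = i + 2) :
    ∑ w ∈ S, F (d w) = #{w ∈ S | d w = i} * F i + #{w ∈ S | d w = i + 1} * F (i + 1) +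
      (#S - #{w ∈ S | d w = i} - #{w ∈ S | d w = i + 1}) * F (i + 2) := by
  have key : ∀ w ∈ S, F (d w) = F (i + 2) + (if d w = i then F i - F (i + 2) else 0) +
      (if d w = i + 1 then F (i + 1) - F (i + 2) else 0) := by
    intro w hw
    rcases h w hw with h | h | h <;> simp [h]
  rw [sum_congr rfl key, sum_add_distrib, sum_add_distrib, sum_const, ← sum_filter, ← sum_filter,
    sum_const, sum_const]
  simp only [nsmul_eq_mul]
  ring

end Fibres

/-- The number `c_i` of a graph with classical parameters `(D, q, α, β)`. -/
noncomputable def classicalC (q α : ℝ) (i : ℕ) : ℝ := qBracket q i * (1 + α * qBracket q (i - 1))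

lemma classicalC_two (q α : ℝ) : classicalC q α 2 = (1 + q) * (1 + α) := by
  simp [classicalC, qBracket, sum_range_succ]

lemma classicalC_three (q α : ℝ) :
    classicalC q α 3 = (1 + q + q ^ 2) * (1 + α * (1 + q)) := by
  simp [classicalC, qBracket, sum_range_succ]

lemma classicalC_four (q α : ℝ) :
    classicalC q α 4 = (1 + q) * (1 + q ^ 2) * (1 + α * (1 + q + q ^ 2)) := by
  simp [classicalC, qBracket, sum_range_succ]
  ring_nf
  simp

/-- The properties of a triangle-free distance-regular graph of negative type from which the
partition of the vertices by their distances to the ends of an edge is shown to be equitable. -/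
structure IsTriangleFreeNegative {X : Type*} [Fintype X] (G : SimpleGraph X) (q α : ℝ)
    (b : ℕ → ℝ) : Prop where
  connected : G.Connected
  triangle_free : ∀ u v w, G.Adj u v → G.Adj v w → ¬ G.Adj u w
  card_lower : ∀ x y, (#(G.lowerNbrs x y) : ℝ) = classicalC q α (G.dist x y)
  card_upper : ∀ x y, (#(G.upperNbrs x y) : ℝ) = b (G.dist x y)
  q_lt : q < -1
  rigid : ∀ f : X → ℝ, ∑ v, f v = 0 → (∀ v, f v * ∑ u, f u * q⁻¹ ^ G.dist u v ≤ 0) →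
    ∀ v, ∑ u, f u * q⁻¹ ^ G.dist u v = 0

namespace IsTriangleFreeNegative

variable {X : Type*} [Fintype X] {G : SimpleGraph X} {q α : ℝ} {b : ℕ → ℝ}
  {x y z u v w : X}

lemma dist_eq_two (h : G.IsTriangleFreeNegative q α b) (hu : G.Adj v u) (hw : G.Adj v w)
    (huw : u ≠ w) : G.dist u w = 2 := by
  have h₁ := h.connected.dist_le_dist_add_one u hw
  rw [dist_eq_one_iff_adj.2 hu.symm] at h₁
  have h₂ := h.connected.one_lt_dist_of_ne_of_not_adj huw (h.triangle_free _ _ _ hu.symm hw)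
  omega

/-- All members of the cell are neighbours of z, so without triangles those other than x lie at
distance exactly two from x. -/
lemma sum_lowerNbrs_pow_dist_self (h : G.IsTriangleFreeNegative q α b)
    (hx : x ∈ G.lowerNbrs y z) (r : ℝ) :
    ∑ w ∈ G.lowerNbrs y z, r ^ G.dist x w =
      1 + (classicalC q α (G.dist y z) - 1) * r ^ 2 := by
  classical
  rw [← add_sum_erase _ _ hx, dist_self, pow_zero]
  have : ∀ w ∈ (G.lowerNbrs y z).erase x, r ^ G.dist x w = r ^ 2 := by
    intro w hw
    rw [mem_erase, mem_lowerNbrs] at hw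
    rw [mem_lowerNbrs] at hx
    rw [h.dist_eq_two hx.1 hw.2.1 hw.1.symm]
  rw [sum_congr rfl this, sum_const, nsmul_eq_mul, cast_card_erase_of_mem hx, h.card_lower]

/-- Given `d(y, z) = i + 2` and a neighbour `x` of `z` at distance `i + 1` from `y`, the sum
of a function of the distance to `x` over the neighbours of `y` at distance `i + 1` from `z`. -/
lemma sum_lowerNbrs_pow_dist (h : G.IsTriangleFreeNegative q α b) {i : ℕ}
    (hyz : G.dist y z = i + 2) (hx : x ∈ G.lowerNbrs y z) (F : ℕ → ℝ) :
    ∑ w ∈ G.lowerNbrs z y, F (G.dist x w) = classicalC q α (i + 1) * F i +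
      #{w ∈ G.lowerNbrs z y | G.dist x w = i + 1} * F (i + 1) +
      (classicalC q α (i + 2) - classicalC q α (i + 1) -
        #{w ∈ G.lowerNbrs z y | G.dist x w = i + 1}) * F (i + 2) := by
  rw [mem_lowerNbrs] at hx
  have hxy : G.dist x y = i + 1 := by rw [dist_comm]; omega
  -- A neighbour of y at distance i from x is automatically at distance i + 1 from z, so c_{i+1}
  -- counts the smallest value; only the split between the other two values remains open.
  have hset : {w ∈ G.lowerNbrs z y | G.dist x w = i} = G.lowerNbrs x y := by
    ext w
    simp only [mem_filter, mem_lowerNbrs, hxy]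
    rw [dist_comm (u := z) (v := y), hyz]
    constructor
    · rintro ⟨⟨h₁, h₂⟩, h₃⟩
      exact ⟨h₁, by omega⟩
    · rintro ⟨h₁, h₂⟩
      have h₃ := h.connected.dist_le_dist_add_one w hx.1.symm
      have h₄ := h.connected.dist_le_dist_add_one z h₁.symm
      rw [dist_comm (u := z) (v := y)] at h₄
      rw [dist_comm (u := w) (v := z), dist_comm (u := w)] at h₃
      exact ⟨⟨h₁, by omega⟩, by omega⟩
  rw [sum_eq_of_three_values (G.lowerNbrs z y) (G.dist x) F i, hset, h.card_lower, h.card_lower,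
    hxy, dist_comm (u := z), hyz]
  intro w hw
  rw [mem_lowerNbrs, dist_comm (u := z) (v := y), hyz] at hw
  have h₃ := h.connected.dist_le_dist_add_one w hx.1
  have h₄ := h.connected.dist_le_dist_add_one w hx.1.symm
  rw [dist_comm (u := w) (v := z), dist_comm (u := w)] at h₃ h₄
  omega

lemma ne_zero (h : G.IsTriangleFreeNegative q α b) : q ≠ 0 := fun e => by
  linarith [h.q_lt]

/-- The difference of the two sums in the balanced set condition at distance three. -/
lemma sum_sub_sum_of_dist_eq_three (h : G.IsTriangleFreeNegative q α b)
    (hyz : G.dist y z = 3) (hx : x ∈ G.lowerNbrs y z) :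
    ∑ w ∈ G.lowerNbrs z y, q⁻¹ ^ G.dist x w - ∑ w ∈ G.lowerNbrs y z, q⁻¹ ^ G.dist x w -
      q * (1 + α * (1 + q)) * (q⁻¹ ^ G.dist x y - q⁻¹ ^ G.dist x z) =
    #{w ∈ G.lowerNbrs z y | G.dist x w = 2} * (q⁻¹ ^ 2 - q⁻¹ ^ 3) := by
  have hq := h.ne_zero
  rw [h.sum_lowerNbrs_pow_dist (i := 1) hyz hx fun n => q⁻¹ ^ n,
    h.sum_lowerNbrs_pow_dist_self hx, hyz]
  rw [mem_lowerNbrs, hyz] at hx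
  rw [dist_comm (u := x) (v := y), show G.dist y x = 2 by omega,
    dist_eq_one_iff_adj.2 hx.1.symm, classicalC_two, classicalC_three]
  simp only [Nat.reduceAdd]
  generalize (#{w ∈ G.lowerNbrs z y | G.dist x w = 2} : ℝ) = N
  field_simp
  ring

/-- The balanced set condition at distance three. -/
lemma balanced_three (h : G.IsTriangleFreeNegative q α b) (hyz : G.dist y z = 3) (v : X) :
    ∑ w ∈ G.lowerNbrs z y, q⁻¹ ^ G.dist v w - ∑ w ∈ G.lowerNbrs y z, q⁻¹ ^ G.dist v w =
      q * (1 + α * (1 + q)) * (q⁻¹ ^ G.dist v y - q⁻¹ ^ G.dist v z) := by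
  classical
  have hq := h.ne_zero
  have hzy : G.dist z y = 3 := by rwa [dist_comm]
  have hpos : 0 < q⁻¹ ^ 2 - q⁻¹ ^ 3 := by
    have : q⁻¹ < 0 := inv_lt_zero.2 (by linarith [h.q_lt])
    nlinarith [sq_nonneg q⁻¹, mul_pos_of_neg_of_neg this this]
  set κ := q * (1 + α * (1 + q)) with hκ
  -- The image of f vanishes at y and z. On the two cells it is a count times r² - r³ > 0, with sign
  -- opposite to f, and elsewhere f is zero. So `rigid` applies.
  set f : X → ℝ := fun v => (if v ∈ G.lowerNbrs z y then 1 else 0) -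
    (if v ∈ G.lowerNbrs y z then 1 else 0) -
    κ * ((if v = y then 1 else 0) - (if v = z then 1 else 0)) with hf
  have hsum : ∀ φ : X → ℝ, ∑ u, f u * φ u = ∑ w ∈ G.lowerNbrs z y, φ w -
      ∑ w ∈ G.lowerNbrs y z, φ w - κ * (φ y - φ z) := by
    intro φ
    simp [hf, sub_mul, sum_sub_distrib, mul_assoc, ← mul_sum, -mem_lowerNbrs]
  -- This is the equation c₃ (r - r²) = κ (1 - r³), which fixes the value of κ.
  have hends : ∀ {y z : X}, G.dist y z = 3 → ∑ w ∈ G.lowerNbrs z y, q⁻¹ ^ G.dist y w -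
      ∑ w ∈ G.lowerNbrs y z, q⁻¹ ^ G.dist y w - κ * (q⁻¹ ^ G.dist y y - q⁻¹ ^ G.dist y z) = 0 := by
    intro y z hyz
    have h₁ : ∀ w ∈ G.lowerNbrs z y, q⁻¹ ^ G.dist y w = q⁻¹ ^ 1 := fun w hw => by
      rw [mem_lowerNbrs] at hw
      rw [dist_eq_one_iff_adj.2 hw.1]
    have h₂ : ∀ w ∈ G.lowerNbrs y z, q⁻¹ ^ G.dist y w = q⁻¹ ^ 2 := fun w hw => by
      rw [mem_lowerNbrs] at hw
      rw [show G.dist y w = 2 by omega]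
    rw [sum_congr rfl h₁, sum_congr rfl h₂, sum_const, sum_const, nsmul_eq_mul, nsmul_eq_mul,
      h.card_lower, h.card_lower, dist_comm (u := z), hyz, dist_self, classicalC_three, hκ]
    field_simp
    ring
  have hdist : ∀ v, ∑ u, f u * q⁻¹ ^ G.dist u v = ∑ w ∈ G.lowerNbrs z y, q⁻¹ ^ G.dist v w -
      ∑ w ∈ G.lowerNbrs y z, q⁻¹ ^ G.dist v w - κ * (q⁻¹ ^ G.dist v y - q⁻¹ ^ G.dist v z) := by
    intro v
    rw [hsum fun u => q⁻¹ ^ G.dist u v]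
    simp only [dist_comm (v := v)]
  have hzero := h.rigid f ?_ ?_ v
  · rw [hdist] at hzero
    linarith
  · have := hsum fun _ => 1
    simp only [mul_one, sub_self, mul_zero, sum_const, nsmul_eq_mul, h.card_lower,
      dist_comm (u := z) (v := y)] at this
    exact this
  · intro v
    rw [hdist]
    by_cases hvy : v = y
    · rw [hvy, hends hyz, mul_zero]
    by_cases hvz : v = z
    · rw [hvz]
      have := hends hzy
      rw [show ∀ a b c d : ℝ, a - b - κ * (c - d) = -(b - a - κ * (d - c)) by intros; ring,
        this, neg_zero, mul_zero]
    by_cases hv₁ : v ∈ G.lowerNbrs z y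
    · have hv₂ : v ∉ G.lowerNbrs y z := by
        rw [mem_lowerNbrs] at hv₁ ⊢
        rw [dist_eq_one_iff_adj.2 hv₁.1]
        omega
      have := h.sum_sub_sum_of_dist_eq_three hzy hv₁
      rw [← hκ] at this
      rw [show ∀ a b c d : ℝ, a - b - κ * (c - d) = -(b - a - κ * (d - c)) by intros; ring,
        this]
      simp only [hf, if_pos hv₁, if_neg hv₂, if_neg hvy, if_neg hvz]
      have := mul_nonneg (Nat.cast_nonneg (α := ℝ) #{w ∈ G.lowerNbrs y z | G.dist v w = 2}) hpos.le
      linarith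
    by_cases hv₂ : v ∈ G.lowerNbrs y z
    · rw [h.sum_sub_sum_of_dist_eq_three hyz hv₂]
      simp only [hf, if_pos hv₂, if_neg hv₁, if_neg hvy, if_neg hvz]
      have := mul_nonneg (Nat.cast_nonneg (α := ℝ) #{w ∈ G.lowerNbrs z y | G.dist v w = 2}) hpos.le
      linarith
    · simp [hf, hv₁, hv₂, hvy, hvz, -mem_lowerNbrs]

/-- The balanced set condition at distance four. -/
lemma balanced_four (h : G.IsTriangleFreeNegative q α b) (hyz : G.dist y z = 4) (v : X) :
    ∑ w ∈ G.lowerNbrs z y, q⁻¹ ^ G.dist v w - ∑ w ∈ G.lowerNbrs y z, q⁻¹ ^ G.dist v w =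
      q * (1 + q) * (1 + α * (1 + q + q ^ 2)) * (q⁻¹ ^ G.dist v y - q⁻¹ ^ G.dist v z) := by
  classical
  set g : X → ℝ := fun w => q⁻¹ ^ G.dist v w with hg
  have hG := h.connected
  -- Sum the condition at distance three over the pairs (y, z') with z' a neighbour of z towards y.
  -- A vertex w of the first cell is reached through c₃ choices of z', a vertex halfway between y
  -- and z through c₂.
  have key : ∀ {y z : X}, G.dist y z = 4 →
      classicalC q α 3 * ∑ w ∈ G.lowerNbrs z y, g w -
        classicalC q α 2 * ∑ w with G.dist y w = 2 ∧ G.dist z w = 2, g w =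
      q * (1 + α * (1 + q)) * (classicalC q α 4 * g y - ∑ w ∈ G.lowerNbrs y z, g w) := by
    intro y z hyz
    have h₁ : ∑ z' ∈ G.lowerNbrs y z, ∑ w ∈ G.lowerNbrs z' y, g w =
        classicalC q α 3 * ∑ w ∈ G.lowerNbrs z y, g w := by
      rw [sum_comm' (t' := G.lowerNbrs z y) (s' := fun w => G.lowerNbrs w z), mul_sum]
      · refine sum_congr rfl fun w hw => ?_
        rw [mem_lowerNbrs, dist_comm (u := z) (v := y), hyz] at hw
        rw [sum_const, nsmul_eq_mul, h.card_lower, dist_comm, show G.dist z w = 3 by omega]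
      · intro z' w
        simp only [mem_lowerNbrs]
        rw [dist_comm (u := z) (v := y), hyz, dist_comm (u := z') (v := y),
          dist_comm (u := z') (v := w), dist_comm (u := z) (v := w)]
        constructor
        · rintro ⟨⟨h₁, h₂⟩, h₃, h₄⟩
          have h₅ := hG.dist_le_dist_add_one w h₁.symm
          have h₆ := hG.dist_le_dist_add_one z h₃.symm
          rw [dist_comm (u := z), dist_comm (u := z), hyz] at h₆
          exact ⟨⟨h₁, by omega⟩, h₃, by omega⟩
        · rintro ⟨⟨h₁, h₂⟩, h₃, h₄⟩
          have h₅ := hG.dist_le_dist_add_one z' h₃.symm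
          have h₆ := hG.dist_le_dist_add_one y h₁.symm
          rw [dist_comm (u := z'), dist_comm (u := z')] at h₅
          exact ⟨⟨h₁, by omega⟩, h₃, by omega⟩
    have h₂ : ∑ z' ∈ G.lowerNbrs y z, ∑ w ∈ G.lowerNbrs y z', g w =
        classicalC q α 2 * ∑ w with G.dist y w = 2 ∧ G.dist z w = 2, g w := by
      rw [sum_comm' (t' := {w | G.dist y w = 2 ∧ G.dist z w = 2})
        (s' := fun w => G.lowerNbrs w z), mul_sum]
      · refine sum_congr rfl fun w hw => ?_
        rw [mem_filter] at hw
        rw [sum_const, nsmul_eq_mul, h.card_lower, dist_comm, hw.2.2]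
      · intro z' w
        simp only [mem_lowerNbrs, mem_filter, mem_univ, true_and]
        rw [hyz, dist_comm (u := z) (v := w)]
        constructor
        · rintro ⟨⟨h₁, h₂⟩, h₃, h₄⟩
          have h₅ := hG.dist_le_dist_add_one w h₁.symm
          have h₆ := hG.dist_triangle (u := y) (v := w) (w := z)
          rw [dist_comm (u := w) (v := z'), dist_eq_one_iff_adj.2 h₃] at h₅ ⊢
          exact ⟨⟨h₁, by omega⟩, by omega, by omega⟩
        · rintro ⟨⟨h₁, h₂⟩, h₃, h₄⟩
          have h₅ : G.dist w z' = 1 := by omega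
          have h₆ := hG.dist_le_dist_add_one y (dist_eq_one_iff_adj.1 h₅)
          have h₇ := hG.dist_le_dist_add_one y h₁.symm
          exact ⟨⟨h₁, by omega⟩, (dist_eq_one_iff_adj.1 h₅).symm, by omega⟩
    rw [← h₁, ← h₂, ← sum_sub_distrib]
    have h₃ : ∀ z' ∈ G.lowerNbrs y z, ∑ w ∈ G.lowerNbrs z' y, g w - ∑ w ∈ G.lowerNbrs y z', g w =
        q * (1 + α * (1 + q)) * (g y - g z') := by
      intro z' hz'
      rw [mem_lowerNbrs] at hz'
      exact h.balanced_three (by omega) v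
    rw [sum_congr rfl h₃, ← mul_sum, sum_sub_distrib, sum_const, nsmul_eq_mul, h.card_lower, hyz]
  have k₁ := key hyz
  -- The sum over the vertices halfway between y and z is symmetric, so it cancels on subtracting
  -- the two versions.
  have k₂ := key (y := z) (z := y) (by rwa [dist_comm])
  simp only [and_comm (a := G.dist z _ = 2)] at k₂
  -- The difference is (1 + q²)(1 + α(1 + q)), and the second factor divides c₃ > 0.
  have hc : classicalC q α 3 - q * (1 + α * (1 + q)) ≠ 0 := by
    have hne : y ≠ z := fun e => by simp [e] at hyz
    obtain ⟨w, -, hw⟩ := hG.exists_adj_dist_add_one hne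
    have hw' : G.dist y w = 3 := by omega
    have hne' : y ≠ w := fun e => by simp [e] at hw'
    obtain ⟨u, hu⟩ := hG.exists_adj_dist_add_one hne'
    have hpos : 0 < classicalC q α 3 := by
      rw [← hw', ← h.card_lower, Nat.cast_pos, card_pos]
      exact ⟨u, mem_lowerNbrs.2 hu⟩
    rw [classicalC_three] at hpos ⊢
    rw [← sub_mul]
    exact mul_ne_zero (by nlinarith) (right_ne_zero_of_mul hpos.ne')
  refine mul_left_cancel₀ hc ?_
  have e : q * (1 + α * (1 + q)) * classicalC q α 4 = (classicalC q α 3 - q * (1 + α * (1 + q))) *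
      (q * (1 + q) * (1 + α * (1 + q + q ^ 2))) := by
    rw [classicalC_three, classicalC_four]
    ring
  change _ = _ * (_ * (g y - g z))
  linear_combination k₁ - k₂ + (g y - g z) * e

end IsTriangleFreeNegative

/-! ### Parallelograms and the distance partition of an edge -/

section Fibres

variable {X : Type*}

lemma sum_eq_of_three_values' (S : Finset X) (d : X → ℕ) (F : ℕ → ℝ) (i : ℕ)
    (h : ∀ w ∈ S, d w = i ∨ d w = i + 1 ∨ d w = i + 2) :
    ∑ w ∈ S, F (d w) = #{w ∈ S | d w = i} * F i +
      (#S - #{w ∈ S | d w = i} - #{w ∈ S | d w = i + 2}) * F (i + 1) +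
      #{w ∈ S | d w = i + 2} * F (i + 2) := by
  have key : ∀ w ∈ S, F (d w) = F (i + 1) + (if d w = i then F i - F (i + 1) else 0) +
      (if d w = i + 2 then F (i + 2) - F (i + 1) else 0) := by
    intro w hw
    rcases h w hw with h | h | h <;> simp [h]
  rw [sum_congr rfl key, sum_add_distrib, sum_add_distrib, sum_const, ← sum_filter, ← sum_filter,
    sum_const, sum_const]
  simp only [nsmul_eq_mul]
  ring

end Fibres

lemma Connected.dist_le_dist_add_one' {X : Type*} {G : SimpleGraph X} {x z : X}
    (hG : G.Connected) (h : G.Adj x z) (w : X) : G.dist z w ≤ G.dist x w + 1 := by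
  rw [dist_comm (u := z), dist_comm (u := x)]
  exact hG.dist_le_dist_add_one w h

namespace IsTriangleFreeNegative

variable {X : Type*} [Fintype X] {G : SimpleGraph X} {q α : ℝ} {b : ℕ → ℝ}
  {x y z w p : X}

lemma inv_neg (h : G.IsTriangleFreeNegative q α b) : q⁻¹ < 0 :=
  inv_lt_zero.2 (by linarith [h.q_lt])

/-- There are no parallelograms of length three or four. -/
lemma dist_add_one_ne (h : G.IsTriangleFreeNegative q α b)
    (hyz : G.dist y z = 3 ∨ G.dist y z = 4) (hx : x ∈ G.lowerNbrs y z)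
    (hw : w ∈ G.lowerNbrs z y) : G.dist x w + 1 ≠ G.dist y z := by
  have hq := h.ne_zero
  have hr := h.inv_neg
  intro hxw
  rcases hyz with hyz | hyz
  · have h₁ := h.sum_sub_sum_of_dist_eq_three hyz hx
    -- The defect in the balanced set condition is a nonzero multiple of the number of
    -- parallelograms, so this number is zero.
    rw [h.balanced_three hyz x, sub_self, eq_comm, mul_eq_zero, Nat.cast_eq_zero,
      card_eq_zero] at h₁
    rcases h₁ with h₁ | h₁
    · exact notMem_empty w (h₁ ▸ mem_filter.2 ⟨hw, by omega⟩)
    · nlinarith [mul_pos_of_neg_of_neg hr hr]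
  · have h₁ := h.balanced_four hyz x
    rw [h.sum_lowerNbrs_pow_dist (i := 2) hyz hx fun n => q⁻¹ ^ n,
      h.sum_lowerNbrs_pow_dist_self hx, hyz] at h₁
    have hx' := hx
    rw [mem_lowerNbrs, hyz] at hx'
    rw [dist_comm (u := x) (v := y), show G.dist y x = 3 by omega,
      dist_eq_one_iff_adj.2 hx'.1.symm] at h₁
    simp only [Nat.reduceAdd, classicalC_three, classicalC_four] at h₁
    have hN : #{w ∈ G.lowerNbrs z y | G.dist x w = 3} ≠ 0 := by
      rw [Ne, card_eq_zero]
      intro e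
      exact notMem_empty w (e ▸ mem_filter.2 ⟨hw, by omega⟩)
    have hN' : (#{w ∈ G.lowerNbrs z y | G.dist x w = 3} : ℝ) ≠ 0 := Nat.cast_ne_zero.2 hN
    generalize (#{w ∈ G.lowerNbrs z y | G.dist x w = 3} : ℝ) = N at h₁ hN'
    -- Unlike at distance three, the condition is already known here; evaluated at x it leaves only
    -- the term in N.
    have h₂ : N * (q - 1) = 0 := by
      field_simp at h₁
      linear_combination h₁
    rcases mul_eq_zero.1 h₂ with h₂ | h₂
    · exact hN' h₂
    · linarith [h.q_lt]

/-- If `x, z` are adjacent and at the same distance `n` from `y`, all neighbours of `y` that are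
further from `x` are further from `z`. -/
lemma dist_of_mem_upperNbrs_of_eq (h : G.IsTriangleFreeNegative q α b) (hxz : G.Adj x z)
    (hy : G.dist x y = 2 ∨ G.dist x y = 3) (hzy : G.dist z y = G.dist x y)
    (hw : w ∈ G.upperNbrs x y) : G.dist z w = G.dist x y + 1 := by
  rw [mem_upperNbrs] at hw
  by_contra hne
  have h₁ := h.connected.dist_le_dist_add_one z hw.1
  have h₂ := h.connected.dist_le_dist_add_one' hxz.symm w
  -- If w were not further from z, then d(z, w) = d(x, y) and x, z, y, w would form a parallelogram
  -- of length d(x, y) + 1.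
  have h₃ := h.dist_add_one_ne (y := w) (z := x) (x := z) (w := y)
    (by rw [dist_comm]; omega)
    (mem_lowerNbrs.2 ⟨hxz, by rw [dist_comm (u := w), dist_comm (u := w)]; omega⟩)
    (mem_lowerNbrs.2 ⟨hw.1.symm, by omega⟩)
  rw [dist_comm (u := w)] at h₃
  omega

/-! ### Sums over the cells of the distance partition of an edge -/

lemma sum_upperNbrs_of_near (h : G.IsTriangleFreeNegative q α b)
    (hy : G.dist z y + 1 = G.dist x y) (hxz : G.Adj x z) (F : ℕ → ℝ) :
    ∑ w ∈ G.upperNbrs x y, F (G.dist z w) = b (G.dist x y) * F (G.dist x y) := by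
  have : ∀ w ∈ G.upperNbrs x y, F (G.dist z w) = F (G.dist x y) := fun w hw => by
    rw [mem_upperNbrs] at hw
    have h₁ := h.connected.dist_le_dist_add_one z hw.1
    have h₂ := h.connected.dist_le_dist_add_one' hxz.symm w
    rw [show G.dist z w = G.dist x y by omega]
  rw [sum_congr rfl this, sum_const, nsmul_eq_mul, h.card_upper]

lemma sum_upperNbrs_of_eq (h : G.IsTriangleFreeNegative q α b) (hxz : G.Adj x z)
    (hy : G.dist x y = 2 ∨ G.dist x y = 3) (hzy : G.dist z y = G.dist x y) (F : ℕ → ℝ) :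
    ∑ w ∈ G.upperNbrs x y, F (G.dist z w) = b (G.dist x y) * F (G.dist x y + 1) := by
  have : ∀ w ∈ G.upperNbrs x y, F (G.dist z w) = F (G.dist x y + 1) := fun w hw => by
    rw [h.dist_of_mem_upperNbrs_of_eq hxz hy hzy hw]
  rw [sum_congr rfl this, sum_const, nsmul_eq_mul, h.card_upper]

/-- The middle value i + 1 of the distance to z is absent, since it would give a parallelogram. -/
lemma sum_lowerNbrs_of_near (h : G.IsTriangleFreeNegative q α b) (hxz : G.Adj x z) {i : ℕ}
    (hi : i = 1 ∨ i = 2) (hy : G.dist x y = i + 2) (hzy : G.dist z y = i + 1) (F : ℕ → ℝ) :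
    ∑ w ∈ G.lowerNbrs x y, F (G.dist z w) = classicalC q α (i + 1) * F i +
      (classicalC q α (i + 2) - classicalC q α (i + 1)) * F (i + 2) := by
  have hz : z ∈ G.lowerNbrs y x :=
    mem_lowerNbrs.2 ⟨hxz, by rw [dist_comm (u := y), dist_comm (u := y)]; omega⟩
  have hyx : G.dist y x = i + 2 := by rwa [dist_comm]
  have h₀ : {w ∈ G.lowerNbrs x y | G.dist z w = i + 1} = ∅ := by
    rw [filter_eq_empty_iff]
    intro w hw hzw
    exact h.dist_add_one_ne (by omega) hz hw (by omega)
  rw [h.sum_lowerNbrs_pow_dist hyx hz, h₀]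
  simp

/-- Distances two and three to z are possible. The balanced set condition for the pair y, x,
evaluated at z, is a linear equation for the number of vertices at distance two, because every
neighbour of x towards y is at distance two from z. -/
lemma sum_lowerNbrs_three_of_eq (h : G.IsTriangleFreeNegative q α b) (hxz : G.Adj x z)
    (hy : G.dist x y = 3) (hzy : G.dist z y = 3) (F : ℕ → ℝ) :
    ∑ w ∈ G.lowerNbrs x y, F (G.dist z w) =
      (classicalC q α 3 - q * (1 + q) * (1 + α * (1 + q))) * F 2 +
        q * (1 + q) * (1 + α * (1 + q)) * F 3 := by
  have hq := h.ne_zero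
  have hyx : G.dist y x = 3 := by rwa [dist_comm]
  have hval : ∀ w ∈ G.lowerNbrs x y, G.dist z w = 1 ∨ G.dist z w = 1 + 1 ∨
      G.dist z w = 1 + 2 := fun w hw => by
    rw [mem_lowerNbrs] at hw
    have h₁ := h.connected.dist_le_dist_add_one z hw.1.symm
    have h₂ := h.connected.dist_le_dist_add_one' hxz w
    omega
  have h₀ : {w ∈ G.lowerNbrs x y | G.dist z w = 1} = ∅ := by
    rw [filter_eq_empty_iff]
    intro w hw hzw
    rw [mem_lowerNbrs] at hw
    have h₁ := h.connected.dist_le_dist_add_one z hw.1.symm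
    omega
  have hsum : ∀ F : ℕ → ℝ, _ := fun F => sum_eq_of_three_values _ _ F 1 hval
  simp only [h₀, card_empty, Nat.cast_zero, zero_mul, zero_add, sub_zero, h.card_lower, hy,
    Nat.reduceAdd] at hsum
  have hbal := h.balanced_three hyx z
  have hself : ∀ w ∈ G.lowerNbrs y x, q⁻¹ ^ G.dist z w = q⁻¹ ^ 2 := fun w hw => by
    rw [mem_lowerNbrs] at hw
    rw [h.dist_eq_two hxz hw.1]
    rintro rfl
    rw [dist_comm] at hzy
    omega
  rw [hsum fun n => q⁻¹ ^ n, sum_congr rfl hself, sum_const, nsmul_eq_mul, h.card_lower, hyx,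
    hzy, dist_eq_one_iff_adj.2 hxz.symm] at hbal
  rw [hsum F]
  generalize (#{w ∈ G.lowerNbrs x y | G.dist z w = 2} : ℝ) = N at hbal ⊢
  have hN : N = classicalC q α 3 - q * (1 + q) * (1 + α * (1 + q)) := by
    have : q - 1 ≠ 0 := fun e => by linarith [h.q_lt]
    refine mul_right_cancel₀ this ?_
    rw [classicalC_three] at *
    field_simp at hbal
    linear_combination hbal
  rw [hN]
  ring

lemma sum_lowerNbrs_four_of_eq (h : G.IsTriangleFreeNegative q α b) (hxz : G.Adj x z)
    (hy : G.dist x y = 4) (hzy : G.dist z y = 4) (F : ℕ → ℝ) :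
    ∑ w ∈ G.lowerNbrs x y, F (G.dist z w) =
      (classicalC q α 4 - q ^ 2 * (1 + q) * (1 + α * (1 + q + q ^ 2))) * F 3 +
        q ^ 2 * (1 + q) * (1 + α * (1 + q + q ^ 2)) * F 4 := by
  have hq := h.ne_zero
  have hyx : G.dist y x = 4 := by rwa [dist_comm]
  have hval : ∀ w ∈ G.lowerNbrs x y, G.dist z w = 2 ∨ G.dist z w = 2 + 1 ∨
      G.dist z w = 2 + 2 := fun w hw => by
    rw [mem_lowerNbrs] at hw
    have h₁ := h.connected.dist_le_dist_add_one z hw.1.symm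
    have h₂ := h.connected.dist_le_dist_add_one' hxz w
    omega
  have h₀ : {w ∈ G.lowerNbrs x y | G.dist z w = 2} = ∅ := by
    rw [filter_eq_empty_iff]
    intro w hw hzw
    rw [mem_lowerNbrs] at hw
    have h₁ := h.connected.dist_le_dist_add_one z hw.1.symm
    omega
  have hsum : ∀ F : ℕ → ℝ, _ := fun F => sum_eq_of_three_values _ _ F 2 hval
  simp only [h₀, card_empty, Nat.cast_zero, zero_mul, zero_add, sub_zero, h.card_lower, hy,
    Nat.reduceAdd] at hsum
  have hbal := h.balanced_four hyx z
  have hself : ∀ w ∈ G.lowerNbrs y x, q⁻¹ ^ G.dist z w = q⁻¹ ^ 2 := fun w hw => by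
    rw [mem_lowerNbrs] at hw
    rw [h.dist_eq_two hxz hw.1]
    rintro rfl
    rw [dist_comm] at hzy
    omega
  rw [hsum fun n => q⁻¹ ^ n, sum_congr rfl hself, sum_const, nsmul_eq_mul, h.card_lower, hyx,
    hzy, dist_eq_one_iff_adj.2 hxz.symm] at hbal
  rw [hsum F]
  generalize (#{w ∈ G.lowerNbrs x y | G.dist z w = 3} : ℝ) = N at hbal ⊢
  have hN : N = classicalC q α 4 - q ^ 2 * (1 + q) * (1 + α * (1 + q + q ^ 2)) := by
    have : q - 1 ≠ 0 := fun e => by linarith [h.q_lt]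
    refine mul_right_cancel₀ this ?_
    rw [classicalC_four] at *
    field_simp at hbal
    linear_combination hbal
  rw [hN]
  ring

lemma sum_lowerNbrs_two_of_adj (h : G.IsTriangleFreeNegative q α b) (hxz : G.Adj x z)
    (hy : G.dist x y = 2) (hzy : G.Adj z y) (F : ℕ → ℝ) :
    ∑ w ∈ G.lowerNbrs x y, F (G.dist z w) = F 0 + (classicalC q α 2 - 1) * F 2 := by
  classical
  have hz : z ∈ G.lowerNbrs x y :=
    mem_lowerNbrs.2 ⟨hzy.symm, by rw [dist_eq_one_iff_adj.2 hxz, hy]⟩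
  rw [← add_sum_erase _ _ hz, dist_self]
  have : ∀ w ∈ (G.lowerNbrs x y).erase z, F (G.dist z w) = F 2 := by
    intro w hw
    rw [mem_erase, mem_lowerNbrs] at hw
    rw [h.dist_eq_two hzy.symm hw.2.1 hw.1.symm]
  rw [sum_congr rfl this, sum_const, nsmul_eq_mul, cast_card_erase_of_mem hz, h.card_lower, hy]

lemma sum_lowerNbrs_two_of_eq (h : G.IsTriangleFreeNegative q α b) (hxz : G.Adj x z)
    (hy : G.dist x y = 2) (hzy : G.dist z y = 2) (F : ℕ → ℝ) :
    ∑ w ∈ G.lowerNbrs x y, F (G.dist z w) = classicalC q α 2 * F 2 := by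
  have : ∀ w ∈ G.lowerNbrs x y, F (G.dist z w) = F 2 := by
    intro w hw
    rw [mem_lowerNbrs] at hw
    rw [h.dist_eq_two hxz (dist_eq_one_iff_adj.1 (by omega))]
    rintro rfl
    rw [dist_eq_one_iff_adj.2 hw.1.symm] at hzy
    omega
  rw [sum_congr rfl this, sum_const, nsmul_eq_mul, h.card_lower, hy]

/-- As d(z, p) = 2, the vertices adjacent to z are the common neighbours of z and p other than x,
and those at distance three from z are all b₂ neighbours of p leading away from z. -/
lemma sum_upperNbrs_one (h : G.IsTriangleFreeNegative q α b) (hxz : G.Adj x z)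
    (hp : G.Adj x p) (hpz : z ≠ p) (F : ℕ → ℝ) :
    ∑ w ∈ G.upperNbrs x p, F (G.dist z w) = (classicalC q α 2 - 1) * F 1 +
      (b 1 - (classicalC q α 2 - 1) - b 2) * F 2 + b 2 * F 3 := by
  classical
  have hG := h.connected
  have hxp := dist_eq_one_iff_adj.2 hp
  have hzp := h.dist_eq_two hxz hp hpz
  have hx : x ∈ G.lowerNbrs z p := mem_lowerNbrs.2
    ⟨hp.symm, by rw [hzp, dist_eq_one_iff_adj.2 hxz.symm]⟩
  have h₁ : {w ∈ G.upperNbrs x p | G.dist z w = 1} = (G.lowerNbrs z p).erase x := by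
    ext w
    simp only [mem_filter, mem_upperNbrs, mem_erase, mem_lowerNbrs, hxp, hzp]
    constructor
    · rintro ⟨⟨h₁, h₂⟩, h₃⟩
      refine ⟨?_, h₁, by omega⟩
      rintro rfl
      rw [dist_self] at h₂
      omega
    · rintro ⟨h₁, h₂, h₃⟩
      exact ⟨⟨h₂, h.dist_eq_two hp.symm h₂ (Ne.symm h₁)⟩, by omega⟩
  have h₃ : {w ∈ G.upperNbrs x p | G.dist z w = 1 + 2} = G.upperNbrs z p := by
    ext w
    simp only [mem_filter, mem_upperNbrs, hxp, hzp]
    constructor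
    · rintro ⟨⟨h₁, h₂⟩, h₃⟩
      exact ⟨h₁, by omega⟩
    · rintro ⟨h₁, h₂⟩
      have h₃ := hG.dist_le_dist_add_one' hxz w
      have h₄ := hG.dist_le_dist_add_one x h₁
      exact ⟨⟨h₁, by omega⟩, by omega⟩
  rw [sum_eq_of_three_values' _ _ F 1, h₁, h₃, cast_card_erase_of_mem hx, h.card_upper,
    h.card_upper, h.card_lower, hxp, hzp]
  intro w hw
  rw [mem_upperNbrs] at hw
  have h₃ := hG.dist_le_dist_add_one' hxz w
  have h₄ := hG.dist_le_dist_add_one' hxz.symm w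
  omega

/-- Exchanging x and z turns the vertices at distances three from x and two from z into a cell
counted by `sum_lowerNbrs_of_near`. Those at distance four from z are all b₃ neighbours of y leading
away from z. -/
lemma sum_upperNbrs_two_of_far (h : G.IsTriangleFreeNegative q α b) (hxz : G.Adj x z)
    (hy : G.dist x y = 2) (hzy : G.dist z y = 3) (F : ℕ → ℝ) :
    ∑ w ∈ G.upperNbrs x y, F (G.dist z w) =
      (classicalC q α 3 - classicalC q α 2) * F 2 +
        (b 2 - (classicalC q α 3 - classicalC q α 2) - b 3) * F 3 + b 3 * F 4 := by
  classical
  have hG := h.connected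
  have h₂ : {w ∈ G.upperNbrs x y | G.dist z w = 2} =
      {w ∈ G.lowerNbrs z y | G.dist x w = 3} := by
    ext w
    simp only [mem_filter, mem_upperNbrs, mem_lowerNbrs, hy, hzy]
    exact ⟨fun ⟨⟨h₁, h₂⟩, h₃⟩ => ⟨⟨h₁, by omega⟩, h₂⟩, fun ⟨⟨h₁, h₂⟩, h₃⟩ => ⟨⟨h₁, h₃⟩, by omega⟩⟩
  have h₂' : (#{w ∈ G.lowerNbrs z y | G.dist x w = 3} : ℝ) =
      classicalC q α 3 - classicalC q α 2 := by
    have := h.sum_lowerNbrs_of_near hxz.symm (i := 1) (Or.inl rfl) hzy hy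
      fun n => if n = 3 then 1 else 0
    simpa using this
  have h₄ : {w ∈ G.upperNbrs x y | G.dist z w = 2 + 2} = G.upperNbrs z y := by
    ext w
    simp only [mem_filter, mem_upperNbrs, hy, hzy]
    constructor
    · rintro ⟨⟨h₁, h₂⟩, h₃⟩
      exact ⟨h₁, by omega⟩
    · rintro ⟨h₁, h₂⟩
      have h₃ := hG.dist_le_dist_add_one' hxz w
      have h₄ := hG.dist_le_dist_add_one x h₁
      exact ⟨⟨h₁, by omega⟩, by omega⟩
  rw [sum_eq_of_three_values' _ _ F 2, h₂, h₄, h₂', h.card_upper, h.card_upper, hy, hzy]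
  intro w hw
  rw [mem_upperNbrs] at hw
  have h₃ := hG.dist_le_dist_add_one' hxz w
  have h₄ := hG.dist_le_dist_add_one' hxz.symm w
  omega

end IsTriangleFreeNegative

/-! ### Raising and lowering functions of the distance to a neighbour of x -/

section Functions

variable {X : Type*} [Fintype X]

/-- The raising operator with respect to `x`, on real functions. -/
noncomputable def raise (G : SimpleGraph X) (x : X) (g : X → ℝ) (y : X) : ℝ :=
  -- The value of Rg at y collects g from below, as for a matrix acting on column vectors.
  ∑ w ∈ G.lowerNbrs x y, g w

/-- The lowering operator with respect to `x`, on real functions. -/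
noncomputable def lower (G : SimpleGraph X) (x : X) (g : X → ℝ) (y : X) : ℝ :=
  ∑ w ∈ G.upperNbrs x y, g w

end Functions

namespace IsTriangleFreeNegative

variable {X : Type*} [Fintype X] {G : SimpleGraph X} {q α : ℝ} {b : ℕ → ℝ}
  {x y z w p : X} {g : X → ℝ} {F : ℕ → ℝ}

lemma lower_of_near (h : G.IsTriangleFreeNegative q α b) (hxz : G.Adj x z)
    (hg : ∀ v, G.dist x v = 3 → g v = F (G.dist z v)) (hy : G.dist x y = 2)
    (hzy : G.dist z y = 1) : G.lower x g y = b 2 * F 2 := by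
  rw [← hy, ← h.sum_upperNbrs_of_near (by omega) hxz F]
  exact sum_congr rfl fun w hw => hg w (by rw [mem_upperNbrs] at hw; omega)

lemma lower_of_eq (h : G.IsTriangleFreeNegative q α b) (hxz : G.Adj x z)
    (hg : ∀ v, G.dist x v = 3 → g v = F (G.dist z v)) (hy : G.dist x y = 2)
    (hzy : G.dist z y = 2) : G.lower x g y = b 2 * F 3 := by
  have := h.sum_upperNbrs_of_eq hxz (Or.inl hy) (by omega) F
  rw [hy] at this
  rw [← this]
  exact sum_congr rfl fun w hw => hg w (by rw [mem_upperNbrs] at hw; omega)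

lemma lower_of_far (h : G.IsTriangleFreeNegative q α b) (hxz : G.Adj x z)
    (hg : ∀ v, G.dist x v = 3 → g v = F (G.dist z v)) (hy : G.dist x y = 2)
    (hzy : G.dist z y = 3) : G.lower x g y = (classicalC q α 3 - classicalC q α 2) * F 2 +
        (b 2 - (classicalC q α 3 - classicalC q α 2) - b 3) * F 3 + b 3 * F 4 := by
  rw [← h.sum_upperNbrs_two_of_far hxz hy hzy F]
  exact sum_congr rfl fun w hw => hg w (by rw [mem_upperNbrs] at hw; omega)

lemma lower_eq_of_const (h : G.IsTriangleFreeNegative q α b) {K : ℝ} {i : ℕ}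
    (hy : G.dist x y = i) (hK : ∀ w ∈ G.upperNbrs x y, g w = K) : G.lower x g y = b i * K := by
  rw [lower, sum_congr rfl hK, sum_const, nsmul_eq_mul, h.card_upper, hy]

/-- The values of `L g` on the second subconstituent, as a function of the distance to `z`. -/
lemma exists_lower_eq (h : G.IsTriangleFreeNegative q α b) (hxz : G.Adj x z)
    (hg : ∀ v, G.dist x v = 3 → g v = F (G.dist z v)) :
    ∃ F' : ℕ → ℝ, (∀ v, G.dist x v = 2 → G.lower x g v = F' (G.dist z v)) ∧
      F' 1 = b 2 * F 2 ∧ F' 2 = b 2 * F 3 ∧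
      F' 3 = (classicalC q α 3 - classicalC q α 2) * F 2 +
        (b 2 - (classicalC q α 3 - classicalC q α 2) - b 3) * F 3 + b 3 * F 4 := by
  refine ⟨fun n => if n = 1 then b 2 * F 2 else if n = 2 then b 2 * F 3 else
    (classicalC q α 3 - classicalC q α 2) * F 2 +
      (b 2 - (classicalC q α 3 - classicalC q α 2) - b 3) * F 3 + b 3 * F 4,
    fun v hv => ?_, by simp, by simp, by simp⟩
  have h₁ := h.connected.dist_le_dist_add_one' hxz v
  have h₂ := h.connected.dist_le_dist_add_one' hxz.symm v
  rcases (by omega : G.dist z v = 1 ∨ G.dist z v = 2 ∨ G.dist z v = 3) with hz | hz | hz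
  · rw [h.lower_of_near hxz hg hv hz]
    simp [hz]
  · rw [h.lower_of_eq hxz hg hv hz]
    simp [hz]
  · rw [h.lower_of_far hxz hg hv hz]
    simp [hz]

/-- The values of `L² g` on the neighbours of `x`, as a function of the distance to `z`. -/
lemma exists_lower_lower_eq (h : G.IsTriangleFreeNegative q α b) (hxz : G.Adj x z)
    (hg : ∀ v, G.dist x v = 2 → g v = F (G.dist z v)) :
    ∃ F' : ℕ → ℝ, (∀ v, G.dist x v = 1 → G.lower x g v = F' (G.dist z v)) ∧
      F' 0 = b 1 * F 1 ∧ F' 2 = (classicalC q α 2 - 1) * F 1 +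
        (b 1 - (classicalC q α 2 - 1) - b 2) * F 2 + b 2 * F 3 := by
  refine ⟨fun n => if n = 0 then b 1 * F 1 else (classicalC q α 2 - 1) * F 1 +
        (b 1 - (classicalC q α 2 - 1) - b 2) * F 2 + b 2 * F 3,
    fun v hv => ?_, by simp, by simp⟩
  have hsum : G.lower x g v = ∑ w ∈ G.upperNbrs x v, F (G.dist z w) :=
    sum_congr rfl fun w hw => hg w (by rw [mem_upperNbrs] at hw; omega)
  rw [hsum]
  by_cases hz : z = v
  · rw [← hz, h.sum_upperNbrs_of_near (by rw [dist_self, dist_eq_one_iff_adj.2 hxz]) hxz,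
      dist_eq_one_iff_adj.2 hxz]
    simp
  · rw [h.sum_upperNbrs_one hxz (dist_eq_one_iff_adj.1 hv) hz,
      h.dist_eq_two hxz (dist_eq_one_iff_adj.1 hv) hz]
    simp

/-- `R L²`, `L R L`, `L² R` and `L` at a vertex at distance two from both ends of an edge. -/
lemma uniform_terms_of_eq (h : G.IsTriangleFreeNegative q α b) (hxz : G.Adj x z)
    (hg : ∀ v, G.dist x v = 3 → g v = F (G.dist z v)) (hy : G.dist x y = 2)
    (hzy : G.dist z y = 2) :
    G.raise x (G.lower x (G.lower x g)) y = classicalC q α 2 *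
        ((classicalC q α 2 - 1) * (b 2 * F 2) +
          (b 1 - (classicalC q α 2 - 1) - b 2) * (b 2 * F 3) +
          b 2 * ((classicalC q α 3 - classicalC q α 2) * F 2 +
            (b 2 - (classicalC q α 3 - classicalC q α 2) - b 3) * F 3 + b 3 * F 4)) ∧
      G.lower x (G.raise x (G.lower x g)) y = b 2 *
        ((classicalC q α 3 - q * (1 + q) * (1 + α * (1 + q))) * (b 2 * F 3) +
          q * (1 + q) * (1 + α * (1 + q)) * ((classicalC q α 3 - classicalC q α 2) * F 2 +
            (b 2 - (classicalC q α 3 - classicalC q α 2) - b 3) * F 3 + b 3 * F 4)) ∧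
      G.lower x (G.lower x (G.raise x g)) y = b 2 * (b 3 *
        ((classicalC q α 4 - q ^ 2 * (1 + q) * (1 + α * (1 + q + q ^ 2))) * F 3 +
          q ^ 2 * (1 + q) * (1 + α * (1 + q + q ^ 2)) * F 4)) ∧
      G.lower x g y = b 2 * F 3 := by
  obtain ⟨F', hF', e₁, e₂, e₃⟩ := h.exists_lower_eq hxz hg
  obtain ⟨F₂, hF₂, e₄, e₅⟩ := h.exists_lower_lower_eq hxz hF'
  have hup : ∀ w ∈ G.upperNbrs x y, G.dist x w = 3 ∧ G.dist z w = 3 := fun w hw => by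
    have := h.dist_of_mem_upperNbrs_of_eq hxz (Or.inl hy) (by omega) hw
    rw [mem_upperNbrs] at hw
    omega
  refine ⟨?_, ?_, ?_, h.lower_of_eq hxz hg hy hzy⟩
  · rw [← e₁, ← e₂, ← e₃, ← e₅, ← h.sum_lowerNbrs_two_of_eq hxz hy hzy F₂]
    exact sum_congr rfl fun w hw => hF₂ w (by rw [mem_lowerNbrs] at hw; omega)
  · rw [← e₂, ← e₃]
    refine h.lower_eq_of_const hy fun w hw => ?_
    obtain ⟨hxw, hzw⟩ := hup w hw
    rw [← h.sum_lowerNbrs_three_of_eq hxz hxw hzw F']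
    exact sum_congr rfl fun v hv => hF' v (by rw [mem_lowerNbrs] at hv; omega)
  · refine h.lower_eq_of_const hy fun w hw => ?_
    obtain ⟨hxw, hzw⟩ := hup w hw
    refine h.lower_eq_of_const hxw fun v hv => ?_
    have hxv : G.dist x v = 4 := by rw [mem_upperNbrs] at hv; omega
    have hzv : G.dist z v = 4 := by
      rw [h.dist_of_mem_upperNbrs_of_eq hxz (Or.inr hxw) (by omega) hv, hxw]
    rw [← h.sum_lowerNbrs_four_of_eq hxz hxv hzv F]
    exact sum_congr rfl fun u hu => hg u (by rw [mem_lowerNbrs] at hu; omega)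

/-- `R L²`, `L R L`, `L² R` and `L` at a vertex at distances two and one from the ends of an
edge. -/
lemma uniform_terms_of_near (h : G.IsTriangleFreeNegative q α b) (hxz : G.Adj x z)
    (hg : ∀ v, G.dist x v = 3 → g v = F (G.dist z v)) (hy : G.dist x y = 2)
    (hzy : G.dist z y = 1) :
    G.raise x (G.lower x (G.lower x g)) y = b 1 * (b 2 * F 2) + (classicalC q α 2 - 1) *
        ((classicalC q α 2 - 1) * (b 2 * F 2) +
          (b 1 - (classicalC q α 2 - 1) - b 2) * (b 2 * F 3) +
          b 2 * ((classicalC q α 3 - classicalC q α 2) * F 2 +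
            (b 2 - (classicalC q α 3 - classicalC q α 2) - b 3) * F 3 + b 3 * F 4)) ∧
      G.lower x (G.raise x (G.lower x g)) y = b 2 *
        (classicalC q α 2 * (b 2 * F 2) + (classicalC q α 3 - classicalC q α 2) *
          ((classicalC q α 3 - classicalC q α 2) * F 2 +
            (b 2 - (classicalC q α 3 - classicalC q α 2) - b 3) * F 3 + b 3 * F 4)) ∧
      G.lower x (G.lower x (G.raise x g)) y = b 2 * (b 3 *
        (classicalC q α 3 * F 2 + (classicalC q α 4 - classicalC q α 3) * F 4)) ∧
      G.lower x g y = b 2 * F 2 := by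
  obtain ⟨F', hF', e₁, e₂, e₃⟩ := h.exists_lower_eq hxz hg
  obtain ⟨F₂, hF₂, e₄, e₅⟩ := h.exists_lower_lower_eq hxz hF'
  have hup : ∀ w ∈ G.upperNbrs x y, G.dist x w = 3 ∧ G.dist z w = 2 := fun w hw => by
    rw [mem_upperNbrs] at hw
    have h₁ := h.connected.dist_le_dist_add_one z hw.1
    have h₂ := h.connected.dist_le_dist_add_one' hxz.symm w
    omega
  refine ⟨?_, ?_, ?_, h.lower_of_near hxz hg hy hzy⟩
  · rw [← e₁, ← e₂, ← e₃, ← e₅, ← e₄,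
      ← h.sum_lowerNbrs_two_of_adj hxz hy (dist_eq_one_iff_adj.1 hzy) F₂]
    exact sum_congr rfl fun w hw => hF₂ w (by rw [mem_lowerNbrs] at hw; omega)
  · rw [← e₁, ← e₃]
    refine h.lower_eq_of_const hy fun w hw => ?_
    obtain ⟨hxw, hzw⟩ := hup w hw
    rw [← h.sum_lowerNbrs_of_near hxz (Or.inl rfl) hxw hzw F']
    exact sum_congr rfl fun v hv => hF' v (by rw [mem_lowerNbrs] at hv; omega)
  · refine h.lower_eq_of_const hy fun w hw => ?_
    obtain ⟨hxw, hzw⟩ := hup w hw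
    refine h.lower_eq_of_const hxw fun v hv => ?_
    have hxv : G.dist x v = 4 := by rw [mem_upperNbrs] at hv; omega
    have hzv : G.dist z v = 3 := by
      rw [mem_upperNbrs] at hv
      have h₁ := h.connected.dist_le_dist_add_one z hv.1
      have h₂ := h.connected.dist_le_dist_add_one' hxz.symm v
      omega
    rw [← h.sum_lowerNbrs_of_near hxz (Or.inr rfl) hxv hzv F]
    exact sum_congr rfl fun u hu => hg u (by rw [mem_lowerNbrs] at hu; omega)

/-- The uniformity equation on the third subconstituent forces relations between its coefficients
and the intersection numbers. -/
lemma relations_of_uniform (h : G.IsTriangleFreeNegative q α b) {em ep f : ℝ}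
    (hu : ∀ g : X → ℝ, (∀ y, G.dist x y ≠ 3 → g y = 0) → ∀ y,
      em * G.raise x (G.lower x (G.lower x g)) y + G.lower x (G.raise x (G.lower x g)) y +
        ep * G.lower x (G.lower x (G.raise x g)) y = f * G.lower x g y)
    (hxz : G.Adj x z) (hy : G.dist x y = 2) (hzy : G.dist z y = 2) (hb : b 2 ≠ 0) :
    em * (classicalC q α 2 * (classicalC q α 3 - 1)) +
        q * (1 + q) * (1 + α * (1 + q)) * (classicalC q α 3 - classicalC q α 2) = 0 ∧
      (b 3 ≠ 0 → em * classicalC q α 2 + q * (1 + q) * (1 + α * (1 + q)) +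
        ep * (q ^ 2 * (1 + q) * (1 + α * (1 + q + q ^ 2))) = 0) := by
  have key : ∀ F : ℕ → ℝ, _ := fun F => h.uniform_terms_of_eq (F := F)
    (g := fun v => if G.dist x v = 3 then F (G.dist z v) else 0) hxz
    (fun v hv => if_pos hv) hy hzy
  constructor
  -- At y the L term is b₂ F(3) and the L²R term involves only F(3) and F(4). The indicator of 2
  -- therefore removes both f and e⁺; the indicator of 4 below removes f alone.
  · obtain ⟨h₁, h₂, h₃, h₄⟩ := key fun n => if n = 2 then 1 else 0
    have h₅ := hu (fun v => if G.dist x v = 3 then (fun n => if n = 2 then 1 else 0) (G.dist z v)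
      else 0) (fun v hv => if_neg hv) y
    rw [h₁, h₂, h₃, h₄] at h₅
    simp only [if_true, Nat.reduceEqDiff, if_false] at h₅
    refine mul_left_cancel₀ hb ?_
    linear_combination h₅
  · intro hb₃
    obtain ⟨h₁, h₂, h₃, h₄⟩ := key fun n => if n = 4 then 1 else 0
    have h₅ := hu (fun v => if G.dist x v = 3 then (fun n => if n = 4 then 1 else 0) (G.dist z v)
      else 0) (fun v hv => if_neg hv) y
    rw [h₁, h₂, h₃, h₄] at h₅
    simp only [if_true, Nat.reduceEqDiff, if_false] at h₅
    refine mul_left_cancel₀ (mul_ne_zero hb hb₃) ?_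
    linear_combination h₅

/-- At a neighbour y of z the L term is b₂ F(2), so the indicators of 4 and 3 remove f. The first is
informative when b₃ ≠ 0; when b₃ = 0 the L²R term vanishes and the second gives a relation for e⁻
alone. -/
lemma relations_of_uniform' (h : G.IsTriangleFreeNegative q α b) {em ep f : ℝ}
    (hu : ∀ g : X → ℝ, (∀ y, G.dist x y ≠ 3 → g y = 0) → ∀ y,
      em * G.raise x (G.lower x (G.lower x g)) y + G.lower x (G.raise x (G.lower x g)) y +
        ep * G.lower x (G.lower x (G.raise x g)) y = f * G.lower x g y)
    (hxz : G.Adj x z) (hy : G.dist x y = 2) (hzy : G.dist z y = 1) (hb : b 2 ≠ 0) :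
    (b 3 ≠ 0 → em * (classicalC q α 2 - 1) + (classicalC q α 3 - classicalC q α 2) +
        ep * (classicalC q α 4 - classicalC q α 3) = 0) ∧
      (b 3 = 0 → em * ((classicalC q α 2 - 1) * (b 1 + 1 - classicalC q α 3)) +
        (classicalC q α 3 - classicalC q α 2) *
          (b 2 - (classicalC q α 3 - classicalC q α 2)) = 0) := by
  have key : ∀ F : ℕ → ℝ, _ := fun F => h.uniform_terms_of_near (F := F)
    (g := fun v => if G.dist x v = 3 then F (G.dist z v) else 0) hxz
    (fun v hv => if_pos hv) hy hzy
  constructor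
  · intro hb₃
    obtain ⟨h₁, h₂, h₃, h₄⟩ := key fun n => if n = 4 then 1 else 0
    have h₅ := hu (fun v => if G.dist x v = 3 then (fun n => if n = 4 then 1 else 0) (G.dist z v)
      else 0) (fun v hv => if_neg hv) y
    rw [h₁, h₂, h₃, h₄] at h₅
    simp only [if_true, Nat.reduceEqDiff, if_false] at h₅
    refine mul_left_cancel₀ (mul_ne_zero hb hb₃) ?_
    linear_combination h₅
  · intro hb₃
    obtain ⟨h₁, h₂, h₃, h₄⟩ := key fun n => if n = 3 then 1 else 0
    have h₅ := hu (fun v => if G.dist x v = 3 then (fun n => if n = 3 then 1 else 0) (G.dist z v)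
      else 0) (fun v hv => if_neg hv) y
    rw [h₁, h₂, h₃, h₄, hb₃] at h₅
    simp only [if_true, Nat.reduceEqDiff, if_false] at h₅
    refine mul_left_cancel₀ hb ?_
    linear_combination h₅

end IsTriangleFreeNegative

/-! ### Inconsistency of the relations -/

/-- The relations between intersection numbers and uniformity coefficients are contradictory when
the diameter is at least four. -/
lemma relations_absurd {q α em ep : ℝ} (hq : q < -1) (hα : α < -1)
    (hc₂ : 1 ≤ classicalC q α 2)
    (h₁ : em * (classicalC q α 2 * (classicalC q α 3 - 1)) +
      q * (1 + q) * (1 + α * (1 + q)) * (classicalC q α 3 - classicalC q α 2) = 0)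
    (h₂ : em * classicalC q α 2 + q * (1 + q) * (1 + α * (1 + q)) +
      ep * (q ^ 2 * (1 + q) * (1 + α * (1 + q + q ^ 2))) = 0)
    (h₃ : em * (classicalC q α 2 - 1) + (classicalC q α 3 - classicalC q α 2) +
      ep * (classicalC q α 4 - classicalC q α 3) = 0) : False := by
  -- These are the counts of neighbours inside the cells (3, 3) and (4, 4) one step closer to both
  -- ends, shifted by one: s and s₄ weight F(3) and F(4) in `sum_lowerNbrs_three_of_eq` and
  -- `sum_lowerNbrs_four_of_eq`.
  set s := q * (1 + q) * (1 + α * (1 + q)) with hs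
  set s₄ := q ^ 2 * (1 + q) * (1 + α * (1 + q + q ^ 2)) with hs₄
  have e₃ : classicalC q α 3 = classicalC q α 2 + (s - q) := by
    rw [classicalC_three, classicalC_two]; ring
  have e₄ : classicalC q α 4 = classicalC q α 3 + (s₄ - q ^ 2) := by
    rw [classicalC_three, classicalC_four]; ring
  have hs_pos : 0 < s := mul_pos (mul_pos_of_neg_of_neg (by linarith) (by linarith))
    (by nlinarith)
  have hq₀ : q ≠ 0 := fun e => by linarith
  have hs₄_pos : 0 < s₄ := by
    rw [hs₄, mul_assoc]
    exact mul_pos (by positivity) (mul_pos_of_neg_of_neg (by linarith) (by nlinarith))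
  rw [e₄, e₃] at h₃
  rw [e₃] at h₁
  clear_value s s₄
  generalize classicalC q α 2 = c at *
  -- eliminate the two coefficients
  have key : (s - q) * s₄ * (c * (c + (s - q) - 1) - s * (c - 1)) =
      s * (s₄ - q ^ 2) * (c * (c - 1)) := by
    linear_combination (c * (c + (s - q) - 1)) * s₄ * h₃
      - (s₄ - q ^ 2) * (c * (c + (s - q) - 1)) * h₂
      - (s₄ * (c - 1) - (s₄ - q ^ 2) * c) * h₁
  have hc₁ : 0 ≤ c - 1 := by linarith
  have hc₀ : 0 < c := by linarith
  have hq' : 0 < -q := by linarith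
  have a₁ : 0 ≤ s * (c * (c - 1)) * q ^ 2 := by positivity
  have a₂ : 0 ≤ -q * s₄ * (c * (c - 1)) := by positivity
  have a₃ : 0 < (s - q) * s₄ * (s + -q * c) := by
    have : 0 < s - q := by linarith
    positivity
  -- The two sides of `key` differ by a sum of two nonnegative terms and one positive term.
  linarith [show (s - q) * s₄ * (s + -q * c) + -q * s₄ * (c * (c - 1)) +
    s * (c * (c - 1)) * q ^ 2 = (s - q) * s₄ * (c * (c + (s - q) - 1) - s * (c - 1)) -
      s * (s₄ - q ^ 2) * (c * (c - 1)) by ring]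

/-- The relations between intersection numbers and uniformity coefficients are contradictory when
the diameter is three. -/
lemma relations_absurd_of_diam_three {q α em b₁ b₂ : ℝ} (hq : q < -1) (hα : α < -1)
    (hb₁ : b₁ = (1 + q + q ^ 2) * (1 - α * (q + q ^ 2)) - 1)
    (hb₂ : b₂ = q ^ 2 * (1 - α * (1 + q) ^ 2))
    (h₁ : em * (classicalC q α 2 * (classicalC q α 3 - 1)) +
      q * (1 + q) * (1 + α * (1 + q)) * (classicalC q α 3 - classicalC q α 2) = 0)
    (h₂ : em * ((classicalC q α 2 - 1) * (b₁ + 1 - classicalC q α 3)) +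
        (classicalC q α 3 - classicalC q α 2) *
          (b₂ - (classicalC q α 3 - classicalC q α 2)) = 0) : False := by
  set γ := classicalC q α 3 - classicalC q α 2 with hγ
  have hγ' : γ = q ^ 2 + α * q * (1 + q) ^ 2 := by
    rw [hγ, classicalC_three, classicalC_two]; ring
  have hαq : 0 < α * q := mul_pos_of_neg_of_neg (by linarith) (by linarith)
  have hq1 : 0 < (1 + q) ^ 2 := by
    have : 1 + q ≠ 0 := fun e => by linarith
    positivity
  have hq₀ : q ≠ 0 := fun e => by linarith
  have hγ_pos : 0 < γ := by rw [hγ']; positivity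
  have hd : b₁ + 1 - classicalC q α 3 = (1 + q + q ^ 2) * (-α) * (1 + q) ^ 2 := by
    rw [hb₁, classicalC_three]; ring
  have hd' : b₂ - γ = -α * q * (1 + q) * (1 + q) ^ 2 := by
    rw [hb₂, hγ']; ring
  rw [hd, hd'] at h₂
  have h₃ : em * ((classicalC q α 2 - 1) * (1 + q + q ^ 2)) + γ * (q * (1 + q)) = 0 := by
    have hne : -α * (1 + q) ^ 2 ≠ 0 := mul_ne_zero (fun e => by linarith) hq1.ne'
    refine mul_left_cancel₀ hne ?_
    linear_combination h₂
  -- Multiplying `h₃` by 1 + α(1 + q) turns 1 + q + q² into c₃ and matches the constant term of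
  -- `h₁`; subtracting leaves e⁻ γ = 0.
  have h₄ : em * (classicalC q α 2 * (classicalC q α 3 - 1) -
      (classicalC q α 2 - 1) * classicalC q α 3) = 0 := by
    have e := classicalC_three q α
    linear_combination h₁ - (1 + α * (1 + q)) * h₃ - em * (classicalC q α 2 - 1) * e
  rw [show classicalC q α 2 * (classicalC q α 3 - 1) -
      (classicalC q α 2 - 1) * classicalC q α 3 = γ by rw [hγ]; ring] at h₄
  have hem : em = 0 := (mul_eq_zero.1 h₄).resolve_right hγ_pos.ne'
  rw [hem, zero_mul, zero_add] at h₃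
  exact (mul_pos hγ_pos (mul_pos_of_neg_of_neg (by linarith) (by linarith))).ne' h₃

/-! ### From the matrices of the flat-deleted graph to real operators -/

section FlatDeleted

variable {X : Type*} {G : SimpleGraph X} {x y : X}

/-- Every edge of a geodesic from x changes the distance to x, so none of them is deleted. -/
lemma Connected.exists_flatDeleted_walk (hG : G.Connected) (x y : X) :
    ∃ p : (G.flatDeleted x).Walk x y, p.length = G.dist x y := by
  induction hn : G.dist x y generalizing y with
  | zero =>
    obtain rfl := hG.dist_eq_zero_iff.1 hn
    exact ⟨.nil, rfl⟩
  | succ n ih =>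
    have hne : x ≠ y := fun e => by simp [e] at hn
    obtain ⟨w, hw, hd⟩ := hG.exists_adj_dist_add_one hne
    obtain ⟨p, hp⟩ := ih w (by omega)
    have ha : (G.flatDeleted x).Adj w y := ⟨hw.symm, by omega⟩
    exact ⟨p.concat ha, by rw [Walk.length_concat, hp]⟩

lemma flatDeleted_le (G : SimpleGraph X) (x : X) : G.flatDeleted x ≤ G := fun _ _ h => h.1

lemma Connected.flatDeleted_reachable (hG : G.Connected) (x y : X) :
    (G.flatDeleted x).Reachable x y :=
  (hG.exists_flatDeleted_walk x y).choose.reachable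

lemma Connected.flatDeleted_dist (hG : G.Connected) (x y : X) :
    (G.flatDeleted x).dist x y = G.dist x y := by
  obtain ⟨p, hp⟩ := hG.exists_flatDeleted_walk x y
  exact le_antisymm (hp ▸ dist_le p) ((hG.flatDeleted_reachable x y).dist_anti (flatDeleted_le G x))

lemma Connected.flatDeleted_eccentricity (hG : G.Connected) {D : ℕ}
    (hD : ∀ y, G.dist x y ≤ D) (hy : G.dist x y = D) : (G.flatDeleted x).eccentricity x = D := by
  have hed : ∀ y, (G.flatDeleted x).edist x y = G.dist x y := fun y => by
    rw [← (hG.flatDeleted_reachable x y).coe_dist_eq_edist, hG.flatDeleted_dist]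
  have : (G.flatDeleted x).eccent x = D := by
    refine le_antisymm ((eccent_le_iff _ _).2 fun v => ?_) ?_
    · rw [hed]
      exact_mod_cast hD v
    · rw [← hy, ← hed]
      exact edist_le_eccent
  rw [eccentricity, this, ENat.toNat_natCast]

/-- A geodesic from x to y passes through distance m and continues outwards; this yields b_m > 0. -/
lemma Connected.exists_upperNbrs_nonempty [Fintype X] (hG : G.Connected) {m : ℕ}
    (hm : m < G.dist x y) : ∃ w, G.dist x w = m ∧ (G.upperNbrs x w).Nonempty := by
  induction hn : G.dist x y generalizing y with
  | zero => omega
  | succ n ih =>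
    have hne : x ≠ y := fun e => by simp [e] at hn
    obtain ⟨w, hw, hd⟩ := hG.exists_adj_dist_add_one hne
    rcases (by omega : m < G.dist x w ∨ m = G.dist x w) with h | h
    · exact ih h (by omega)
    · exact ⟨w, h.symm, y, mem_upperNbrs.2 ⟨hw.symm, hd.symm⟩⟩

variable [Fintype X] [DecidableEq X]

lemma Connected.loweringMatrix_mulVec (hG : G.Connected)
    (hx : ∀ y, G.dist x y ≤ (G.flatDeleted x).eccentricity x) (g : X → ℝ) :
    (G.flatDeleted x).loweringMatrix x *ᵥ (fun v => (g v : ℂ)) =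
      fun v => ((G.lower x g v : ℝ) : ℂ) := by
  classical
  ext y
  have hentry : ∀ w, (G.flatDeleted x).loweringMatrix x y w =
      if w ∈ G.upperNbrs x y then 1 else 0 := by
    intro w
    simp only [loweringMatrix, dualIdempotent, complexAdjMatrix, Matrix.sum_apply,
      Matrix.mul_diagonal, Matrix.diagonal_mul, adjMatrix_apply, hG.flatDeleted_dist]
    rw [sum_eq_single (G.dist x w)]
    · by_cases h : w ∈ G.upperNbrs x y
      · rw [if_pos h]
        rw [mem_upperNbrs] at h
        rw [if_pos (by omega), if_pos ⟨h.1, by omega⟩, if_pos rfl]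
        simp
      · rw [if_neg h]
        rw [mem_upperNbrs] at h
        by_cases hd : G.dist x y = G.dist x w - 1
        · rw [if_neg (c := (G.flatDeleted x).Adj y w)]
          · simp
          · rintro ⟨h₁, h₂⟩
            exact h ⟨h₁, by omega⟩
        · simp [hd]
    · intro i _ hi
      simp [Ne.symm hi]
    · intro hi
      -- The index d(x, w) is outside the summation range only for w = x, whose column in the
      -- lowering matrix is zero.
      have h₀ : G.dist x w = 0 := by
        rw [mem_Icc] at hi
        have := hx w
        omega
      obtain rfl := hG.dist_eq_zero_iff.1 h₀
      by_cases hd : G.dist x y = 0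
      · rw [if_neg (c := (G.flatDeleted x).Adj y x)]
        · simp
        · rintro ⟨h₁, h₂⟩
          rw [dist_self] at h₂
          exact h₂ hd
      · simp [hd]
  simp only [mulVec, dotProduct, hentry, ite_mul, one_mul, zero_mul]
  rw [← sum_filter, filter_mem_eq_inter, univ_inter, lower, Complex.ofReal_sum]

lemma Connected.raisingMatrix_mulVec (hG : G.Connected)
    (hx : ∀ y, G.dist x y ≤ (G.flatDeleted x).eccentricity x) (g : X → ℝ) :
    (G.flatDeleted x).raisingMatrix x *ᵥ (fun v => (g v : ℂ)) =
      fun v => ((G.raise x g v : ℝ) : ℂ) := by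
  classical
  ext y
  have hentry : ∀ w, (G.flatDeleted x).raisingMatrix x y w =
      if w ∈ G.lowerNbrs x y then 1 else 0 := by
    intro w
    simp only [raisingMatrix, dualIdempotent, complexAdjMatrix, Matrix.sum_apply,
      Matrix.mul_diagonal, Matrix.diagonal_mul, adjMatrix_apply, hG.flatDeleted_dist]
    rw [sum_eq_single (G.dist x w)]
    · by_cases h : w ∈ G.lowerNbrs x y
      · rw [if_pos h]
        rw [mem_lowerNbrs] at h
        rw [if_pos (by omega), if_pos ⟨h.1, by omega⟩, if_pos rfl]
        simp
      · rw [if_neg h]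
        rw [mem_lowerNbrs] at h
        by_cases hd : G.dist x y = G.dist x w + 1
        · rw [if_neg (c := (G.flatDeleted x).Adj y w)]
          · simp
          · rintro ⟨h₁, h₂⟩
            exact h ⟨h₁, by omega⟩
        · simp [hd]
    · intro i _ hi
      simp [Ne.symm hi]
    · intro hi
      have hd : G.dist x y ≠ G.dist x w + 1 := by
        rw [mem_range] at hi
        have := hx y
        omega
      simp [hd]
  simp only [mulVec, dotProduct, hentry, ite_mul, one_mul, zero_mul]
  rw [← sum_filter, filter_mem_eq_inter, univ_inter, raise, Complex.ofReal_sum]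

/-- A uniform structure gives, on each subconstituent, a relation between the raising and lowering
operators with real coefficients. -/
lemma Connected.exists_real_uniform_relation (hG : G.Connected)
    (hx : ∀ y, G.dist x y ≤ (G.flatDeleted x).eccentricity x)
    (hu : G.SupportsUniformStructure x) {i : ℕ} (hi₁ : 1 ≤ i)
    (hi₂ : i ≤ (G.flatDeleted x).eccentricity x) :
    ∃ em ep f : ℝ, ∀ g : X → ℝ, (∀ y, G.dist x y ≠ i → g y = 0) → ∀ y,
      em * G.raise x (G.lower x (G.lower x g)) y + G.lower x (G.raise x (G.lower x g)) y +
        ep * G.lower x (G.lower x (G.raise x g)) y = f * G.lower x g y := by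
  obtain ⟨U, f, hU⟩ := hu
  -- L and R are real, so on real functions the real part of the equation has the real parts of the
  -- coefficients.
  refine ⟨(eMinus U i).re, (ePlus ((G.flatDeleted x).eccentricity x) U i).re, (f i).re,
    fun g hg y => ?_⟩
  have hmem : (fun v => (g v : ℂ)) ∈ (G.flatDeleted x).subconstituent x i := by
    refine ⟨fun v => (g v : ℂ), ?_⟩
    ext v
    simp only [dualIdempotent, mulVecLin_apply, mulVec_diagonal, hG.flatDeleted_dist]
    by_cases hv : G.dist x v = i
    · simp [hv]
    · simp [hg v hv]
  have h := congrFun (hU.uniform i (mem_Icc.2 ⟨hi₁, hi₂⟩) _ hmem) y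
  simp only [add_mulVec, smul_mulVec, pow_two, ← mulVec_mulVec, hG.loweringMatrix_mulVec hx,
    hG.raisingMatrix_mulVec hx, Pi.add_apply, Pi.smul_apply, smul_eq_mul] at h
  simpa using congrArg Complex.re h

end FlatDeleted

/-! ### Consequences of classical parameters -/

section ClassicalParameters

variable {X : Type*} [Fintype X] {G : SimpleGraph X} {p : ℕ → ℕ → ℕ → ℕ} {q α β : ℝ} {x y z : X}

/-- The number `b_i` of a graph with classical parameters `(D, q, α, β)`. -/
noncomputable def classicalB (D : ℕ) (q α β : ℝ) (i : ℕ) : ℝ :=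
  (qBracket q D - qBracket q i) * (β - α * qBracket q i)

lemma qBracket_eq (hq : q ≠ 1) (j : ℕ) : qBracket q j = (q ^ j - 1) / (q - 1) :=
  geom_sum_eq hq j

lemma IsDistanceRegularWith.dist_le_diam (h : G.IsDistanceRegularWith p) (y z : X) :
    G.dist y z ≤ G.diam :=
  have := h.1.nonempty
  SimpleGraph.dist_le_diam (connected_iff_ediam_ne_top.1 h.1)

lemma IsDistanceRegularWith.card_lowerNbrs (h : G.IsDistanceRegularWith p) (hD : 1 ≤ G.diam)
    (hc : HasClassicalParameters p G.diam q α β) (x y : X) :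
    (#(G.lowerNbrs x y) : ℝ) = classicalC q α (G.dist x y) := by
  have hle := h.dist_le_diam x y
  rcases Nat.eq_zero_or_pos (G.dist x y) with h₀ | h₀
  · have : G.lowerNbrs x y = ∅ := by
      ext w
      simp [h₀]
    rw [this, h₀]
    simp [classicalC, qBracket]
  · rw [classicalC, ← hc.1 _ h₀ hle,
      ← h.2 (G.dist x y) 1 (G.dist x y - 1) hle hD (by omega) y x (dist_comm),
      ← Set.ncard_coe_finset]
    congr 2
    ext w
    simp only [mem_coe, mem_lowerNbrs, Set.mem_ofPred_eq, dist_eq_one_iff_adj]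
    exact and_congr_right fun _ => by omega

lemma IsDistanceRegularWith.card_upperNbrs (h : G.IsDistanceRegularWith p) (hD : 1 ≤ G.diam)
    (hc : HasClassicalParameters p G.diam q α β) (x y : X) :
    (#(G.upperNbrs x y) : ℝ) = classicalB G.diam q α β (G.dist x y) := by
  have hle := h.dist_le_diam x y
  rcases hle.eq_or_lt with h₀ | h₀
  · have : G.upperNbrs x y = ∅ := by
      ext w
      have := h.dist_le_diam x w
      simp only [mem_upperNbrs, notMem_empty, iff_false]
      omega
    rw [this, h₀]
    simp [classicalB]
  · rw [classicalB, ← hc.2 _ h₀, ← h.2 (G.dist x y) 1 (G.dist x y + 1) hle hD h₀ y x (dist_comm),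
      ← Set.ncard_coe_finset]
    congr 2
    ext w
    simp only [mem_coe, mem_upperNbrs, Set.mem_ofPred_eq, dist_eq_one_iff_adj]

lemma IsDistanceRegularWith.triangle_free (h : G.IsDistanceRegularWith p) (hD : 1 ≤ G.diam)
    (ha₁ : p 1 1 1 = 0) (u v w : X) (huv : G.Adj u v) (hvw : G.Adj v w) : ¬ G.Adj u w := by
  intro huw
  have := h.2 1 1 1 hD hD hD u v (dist_eq_one_iff_adj.2 huv)
  rw [ha₁, Set.ncard_eq_zero, Set.eq_empty_iff_forall_notMem] at this
  exact this w ⟨dist_eq_one_iff_adj.2 huw, dist_eq_one_iff_adj.2 hvw⟩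

/-- The function `q⁻¹ ^ i` and the constants span an invariant space of the intersection matrix. -/
lemma classicalC_mul_add_classicalB_mul (hq : q < -1) (D i : ℕ) :
    classicalC q α i * (q⁻¹ ^ (i - 1) - q⁻¹ ^ i) +
        classicalB D q α β i * (q⁻¹ ^ (i + 1) - q⁻¹ ^ i) =
      (-(1 - α / (q - 1)) - q ^ D / q * (β + α / (q - 1))) * q⁻¹ ^ i +
        (1 - α / (q - 1) - α / (q * (q - 1)) + q⁻¹ * (β + α / (q - 1)) +
          q ^ D / q * (α / (q - 1))) := by
  have hq₀ : q ≠ 0 := fun e => by linarith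
  have hq₁ : q ≠ 1 := fun e => by linarith
  have hq₂ : q - 1 ≠ 0 := sub_ne_zero.2 hq₁
  unfold classicalC classicalB
  rcases i with _ | i
  · simp only [qBracket_eq hq₁]
    simp
    field_simp
    ring
  · simp only [qBracket_eq hq₁, Nat.add_sub_cancel, pow_succ, inv_pow]
    have ht : q ^ i ≠ 0 := pow_ne_zero i hq₀
    generalize q ^ i = t at ht
    field_simp
    ring

lemma IsDistanceRegularWith.degree_eq (h : G.IsDistanceRegularWith p) (hD : 1 ≤ G.diam)
    (hc : HasClassicalParameters p G.diam q α β) [DecidableRel G.Adj] (y : X) :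
    (G.degree y : ℝ) = classicalB G.diam q α β 0 := by
  have : G.neighborFinset y = G.upperNbrs y y := by
    ext w
    simp [dist_eq_one_iff_adj]
  rw [← card_neighborFinset_eq_degree, this, h.card_upperNbrs hD hc, dist_self]

/-- This is the equation a₁ = b₀ - b₁ - c₁ = 0 solved for β. -/
lemma IsDistanceRegularWith.beta_eq (h : G.IsDistanceRegularWith p) (hD : 1 ≤ G.diam)
    (hc : HasClassicalParameters p G.diam q α β) (ha₁ : p 1 1 1 = 0) :
    β = 1 - α * (qBracket q G.diam - 1) := by
  classical
  have := nontrivial_of_diam_ne_zero (by omega : G.diam ≠ 0)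
  obtain ⟨x, y, hxy⟩ := exists_pair_ne X
  obtain ⟨y, hy, -⟩ := h.1.exists_adj_dist_add_one hxy.symm
  have hd := dist_eq_one_iff_adj.2 hy
  have h₁ := h.1.sum_neighborFinset_dist (fun n => if n = 1 then 1 else 0) x y
  rw [sum_eq_zero, h.degree_eq hD hc, h.card_lowerNbrs hD hc, h.card_upperNbrs hD hc, hd] at h₁
  · simp [classicalB, classicalC, qBracket] at h₁
    simp only [qBracket]
    linarith
  · intro w hw
    rw [mem_neighborFinset] at hw
    rw [if_neg]
    rw [dist_eq_one_iff_adj]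
    exact h.triangle_free hD ha₁ x y w hy hw

lemma IsDistanceRegularWith.isTriangleFreeNegative (h : G.IsDistanceRegularWith p)
    (hD : 1 ≤ G.diam) (hc : HasClassicalParameters p G.diam q α β) (hq : q < -1)
    (ha₁ : p 1 1 1 = 0) : G.IsTriangleFreeNegative q α (classicalB G.diam q α β) where
  connected := h.1
  triangle_free := h.triangle_free hD ha₁
  card_lower := h.card_lowerNbrs hD hc
  card_upper := h.card_upperNbrs hD hc
  q_lt := hq
  rigid := by
    classical
    have := nontrivial_of_diam_ne_zero (by omega : G.diam ≠ 0)
    obtain ⟨s, hs, hsum⟩ := exists_sum_mul_sum_pow_dist h (r := q⁻¹)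
      (by rw [abs_inv, abs_of_neg (by linarith)]; exact inv_lt_one_of_one_lt₀ (by linarith))
      (h.degree_eq hD hc) (h.card_lowerNbrs hD hc) (h.card_upperNbrs hD hc)
      fun i _ => classicalC_mul_add_classicalB_mul hq G.diam i
    exact fun f => sum_pow_dist_eq_zero hs hsum

end ClassicalParameters

/-! ### Conclusion -/

/-- A triangle-free distance-regular graph of negative type and diameter at least three does not
support a uniform structure. It is automatically non-bipartite, because `c₂ ≥ 1` forces `α < 0`. -/
theorem IsDistanceRegularWith.not_supportsUniformStructure {X : Type*} [Fintype X] [DecidableEq X]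
    {Γ : SimpleGraph X} {p : ℕ → ℕ → ℕ → ℕ} (hΓ : Γ.IsDistanceRegularWith p) (hD : 3 ≤ Γ.diam)
    (hneg : IsNegativeType p Γ.diam) (ha₁ : p 1 1 1 = 0) (x : X) :
    ¬ Γ.SupportsUniformStructure x := by
  classical
  intro hsupp
  obtain ⟨q, α, β, hc, hq⟩ := hneg
  have hD₁ : 1 ≤ Γ.diam := by omega
  have hT := hΓ.isTriangleFreeNegative hD₁ hc hq ha₁
  have hβ := hΓ.beta_eq hD₁ hc ha₁
  -- The number of vertices at distance D from a vertex does not depend on the vertex, so x has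
  -- eccentricity D.
  obtain ⟨y₀, hy₀⟩ : ∃ y, Γ.dist x y = Γ.diam := by
    have := hΓ.1.nonempty
    obtain ⟨u, v, huv⟩ := Γ.exists_dist_eq_diam
    have h₁ := hΓ.2 0 Γ.diam Γ.diam (Nat.zero_le _) le_rfl le_rfl
    have h₂ : p 0 Γ.diam Γ.diam ≠ 0 := by
      rw [← h₁ u u dist_self]
      exact Set.ncard_ne_zero_of_mem (a := v) ⟨huv, huv⟩
    rw [← h₁ x x dist_self] at h₂
    obtain ⟨y, hy⟩ := Set.nonempty_of_ncard_ne_zero h₂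
    exact ⟨y, hy.1⟩
  have hb : ∀ i < Γ.diam, 0 < classicalB Γ.diam q α β i := by
    intro i hi
    obtain ⟨w, hw, hne⟩ := hΓ.1.exists_upperNbrs_nonempty (x := x) (y := y₀) (by omega : i < _)
    rw [← hw, ← hT.card_upper, Nat.cast_pos, Finset.card_pos]
    exact hne
  have hecc := hΓ.1.flatDeleted_eccentricity (hΓ.dist_le_diam x) hy₀
  obtain ⟨em, ep, f, hu⟩ := hΓ.1.exists_real_uniform_relation
    (fun y => hecc ▸ hΓ.dist_le_diam x y) hsupp (i := 3) (by omega) (by omega)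
  obtain ⟨y, hy, -⟩ := hΓ.1.exists_upperNbrs_nonempty (x := x) (y := y₀) (by omega : 2 < _)
  have hyx : Γ.dist y x = 2 := by rwa [SimpleGraph.dist_comm]
  have hxy : x ≠ y := fun e => by simp [e] at hy
  obtain ⟨z₁, hz₁, hz₁'⟩ := hΓ.1.exists_adj_dist_add_one hxy.symm
  have hzy₁ : Γ.dist z₁ y = 1 := by rw [SimpleGraph.dist_comm]; omega
  have hc₂ : 1 ≤ classicalC q α 2 := by
    rw [← hyx, ← hT.card_lower, Nat.one_le_cast, Finset.one_le_card]
    exact ⟨z₁, mem_lowerNbrs.2 ⟨hz₁, hz₁'⟩⟩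
  -- Here c₂ = (1 + q)(1 + α) is positive while 1 + q < 0.
  have hα : α < -1 := by
    rw [classicalC_two] at hc₂
    nlinarith
  have hB₂ : qBracket q 2 = 1 + q := by simp [qBracket, Finset.sum_range_succ]
  have hB₁ : qBracket q 1 = 1 := by simp [qBracket]
  have hB₀ : qBracket q 0 = 0 := by simp [qBracket]
  -- Such a vertex exists because a₂ = b₀ - b₂ - c₂ = -α(1 + q)² > 0, by the value of β.
  obtain ⟨z₂, hz₂, hzy₂⟩ : ∃ z, Γ.Adj x z ∧ Γ.dist y z = 2 := by
    have h₁ := hΓ.1.sum_neighborFinset_dist (fun n => if n = 2 then 1 else 0) y x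
    rw [hΓ.degree_eq hD₁ hc, hT.card_lower, hT.card_upper, hyx] at h₁
    have h₂ : 0 < -α * (1 + q) ^ 2 :=
      mul_pos (by linarith) (sq_pos_of_ne_zero fun e => by linarith)
    by_contra! hno
    rw [Finset.sum_eq_zero] at h₁
    · simp [classicalB, classicalC_two, hB₂, hB₀] at h₁
      rw [hβ] at h₁
      linarith
    · intro w hw
      rw [mem_neighborFinset] at hw
      rw [if_neg (hno w hw)]
  have hb₂ := (hb 2 (by omega)).ne'
  obtain ⟨r₁, r₂⟩ := hT.relations_of_uniform hu hz₂ hy (by rwa [SimpleGraph.dist_comm]) hb₂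
  obtain ⟨r₃, r₄⟩ := hT.relations_of_uniform' hu hz₁ hy hzy₁ hb₂
  rcases hD.eq_or_lt with hD₃ | hD₃
  · have hB₃ : qBracket q 3 = 1 + q + q ^ 2 := by simp [qBracket, Finset.sum_range_succ]
    rw [← hD₃, hB₃] at hβ
    refine relations_absurd_of_diam_three hq hα ?_ ?_ r₁ (r₄ ?_)
    · rw [classicalB, ← hD₃, hB₃, hB₁, hβ]
      ring
    · rw [classicalB, ← hD₃, hB₃, hB₂, hβ]
      ring
    · rw [classicalB, ← hD₃, sub_self, zero_mul]
  · have hb₃ := (hb 3 hD₃).ne'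
    exact relations_absurd hq hα hc₂ r₁ (r₂ hb₃) (r₃ hb₃)

end SimpleGraph

theorem theorem7p2 {X : Type*} [Fintype X] [DecidableEq X] (Γ : SimpleGraph X)
    (p : ℕ → ℕ → ℕ → ℕ) (hΓ : Γ.IsDistanceRegularWith p) (hbip : ¬ Γ.IsBipartite)
    (hD : 3 ≤ Γ.diam) (hneg : SimpleGraph.IsNegativeType p Γ.diam) (ha₁ : p 1 1 1 = 0)
    (x : X) :
    ¬ Γ.SupportsUniformStructure x :=
  hΓ.not_supportsUniformStructure hD hneg ha₁ x
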